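/- **Theorem (the range of $W$ is complemented).** Let $\mathcal A,\mathcal B,\mathcal C$ be unital $C^*$-algebras, let $\mathbf E$ be an $\mathcal A$–$\mathcal B$ correspondence (a right Hilbert $\mathcal B$-module on which $\mathcal A$ acts from the left through a unital $*$-homomorphism into the adjointable operators; inner products are linear in the second variable), and let $\mathbf G$ be a right Hilbert $\mathcal C$-module. Let $\mathcal B\otimes\mathcal C$ be the minimal $C^*$-tensor product and let $\mathbf H=\mathbf E\otimes\mathbf G$ be the exterior tensor product, a Hilbert $\mathcal B\otimes\mathcal C$-module. Let $(X,\mu)$ be a finite measure space. Let $(F_k)$ be a finite or countably infinite family of strongly $\mu$-measurable maps $F_k:X\to\mathbf E$ such that $\langle F_k(\cdot)\mid F_k(\cdot)\rangle$ is Bochner integrable and $$\int_X F_k(x)\,\langle F_l(x)\mid e\rangle\,d\mu(x)=\delta_{kl}\,e\qquad(e\in\mathbf E),$$ and let $(\phi_k)$ be elements of $\mathbf G$, with the same index set, such that $\sum_k\phi_k\langle\phi_k\mid g\rangle=g$ for all $g\in\mathbf G$ and $\langle\phi_k\mid\phi_l\rangle=\delta_{kl}\,\mathrm{id}_{\mathcal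 C}$. Assume that for every $x\in X$ the series $$|x,\mathrm{id}_{\mathcal A}\rangle=\sum_k F_k(x)\otimes\phi_k$$ converges (unconditionally) in $\mathbf H$, and put $K(x,y)=\langle x,\mathrm{id}_{\mathcal A}\mid y,\mathrm{id}_{\mathcal A}\rangle\in\mathcal B\otimes\mathcal C$. Let $\widetilde{\mathfrak H}$ be the inner product $\mathcal B\otimes\mathcal C$-module of ($\mu$-a.e. equivalence classes of) strongly measurable maps $h:X\to\mathcal B\otimes\mathcal C$ for which $h(\cdot)^*h(\cdot)$ is Pettis integrable, with $(hd)(x)=h(x)d$ and $\langle h_1\mid h_2\rangle=\int_X h_1(x)^*h_2(x)\,d\mu(x)$ (Pettis integral). Then: 1. $(Wf)(x)=\langle x,\mathrm{id}_{\mathcal A}\mid f\rangle$ defines a $\mathcal B\otimes\mathcal C$-linear map $W:\mathbf H\to\widetilde{\mathfrak H}$, and it is an isometry: $\langle Wf\mid Wf'\rangle=\langle f\mid f'\rangle$ for all $f,f'\in\mathbf H$. 2. For all $h\in\widetilde{\mathfrak H}$ and $x\in X$ the function $y\mapsto K(x,y)h(y)$ is Pettis integrable, and $$(\mathbb P_Kh)(x)=\int_X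 K(x,y)\,h(y)\,d\mu(y)$$ defines a projection $\mathbb P_K$ on $\widetilde{\mathfrak H}$, that is, a $\mathcal B\otimes\mathcal C$-linear map with $\mathbb P_K^2=\mathbb P_K$ and $\langle\mathbb P_Kh\mid h'\rangle=\langle h\mid\mathbb P_Kh'\rangle$. 3. The range $\mathfrak H_K$ of $W$ is the range of $\mathbb P_K$, and it is a complemented submodule: $\widetilde{\mathfrak H}=\mathfrak H_K\oplus\mathfrak H_K^\perp$. The same holds in the Hilbert module completion of $\widetilde{\mathfrak H}$: if $\mathcal M$ is a Hilbert $\mathcal B\otimes\mathcal C$-module and $j:\widetilde{\mathfrak H}\to\mathcal M$ is a module map that preserves inner products and has dense range, then $\mathbb P_K$ extends to a projection $Q$ of $\mathcal M$ (so $Qj=j\mathbb P_K$) with range $j(\mathfrak H_K)$, and $\mathcal M=j(\mathfrak H_K)\oplus j(\mathfrak H_K)^\perp$. -/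

import Mathlib

open MeasureTheory MulOpposite UniformSpace
open scoped TensorProduct ComplexOrder

/-- A (right) inner product module over a C⋆-algebra `B`: the inner product is `B`-valued,
conjugate-linear in the first and linear in the second variable, and `⟨x, y b⟩ = ⟨x, y⟩ b`.
The right action of `b` on `y` is `op b • y`.  (Mathlib's `CStarModule` is the mirror image
of this notion: there `⟨x, a • y⟩ = a * ⟨x, y⟩`.) -/
class InnerProductModule (B E : Type*) [CStarAlgebra B] [AddCommGroup E] [Module ℂ E]
    [Module Bᵐᵒᵖ E] where
  /-- the `B`-valued inner product -/
  ip : E → E → B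
  ip_add_right : ∀ x y z, ip x (y + z) = ip x y + ip x z
  ip_smul_right : ∀ (c : ℂ) x y, ip x (c • y) = c • ip x y
  ip_op_smul_right : ∀ (b : B) x y, ip x (op b • y) = ip x y * b
  star_ip : ∀ x y, star (ip x y) = ip y x
  /-- `⟨x, x⟩` is a positive element of `B` -/
  ip_self_nonneg : ∀ x, ∃ b : B, ip x x = star b * b
  eq_zero_of_ip_self : ∀ x, ip x x = 0 → x = 0

/-- A (right) Hilbert C⋆-module over `B`: an inner product module, complete in the norm
`‖x‖ = ‖⟨x, x⟩‖ ^ (1/2)`. -/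
class HilbertModule (B E : Type*) [CStarAlgebra B] [NormedAddCommGroup E] [NormedSpace ℂ E]
    [Module Bᵐᵒᵖ E] extends InnerProductModule B E where
  norm_sq_eq : ∀ x, ‖x‖ ^ 2 = ‖ip x x‖
  complete : CompleteSpace E

/-- `E` is an `A`-`B` correspondence: the Hilbert `B`-module `E` carries a unital left action of
`A` by adjointable operators, the adjoint of the action of `a` being the action of `a⋆`.  (Such
an action is the same as a unital ⋆-homomorphism from `A` to the adjointable operators.) -/
class IsCorrespondence (A B E : Type*) [CStarAlgebra A] [CStarAlgebra B] [NormedAddCommGroup E]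
    [NormedSpace ℂ E] [Module Bᵐᵒᵖ E] [HilbertModule B E] [Module A E] : Prop where
  smul_assoc : ∀ (c : ℂ) (a : A) (x : E), (c • a) • x = c • (a • x)
  ip_smul_left : ∀ (a : A) (x y : E),
    InnerProductModule.ip (B := B) (a • x) y = InnerProductModule.ip (B := B) x (star a • y)

namespace InnerProductModule

variable (B : Type*) {E : Type*} [CStarAlgebra B]

section basic
variable [AddCommGroup E] [Module ℂ E] [Module Bᵐᵒᵖ E] [InnerProductModule B E]

theorem ip_add_left (x y z : E) : ip (B := B) (x + y) z = ip x z + ip y z := by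
  rw [← star_ip, ip_add_right, star_add, star_ip, star_ip]

theorem ip_smul_left (c : ℂ) (x y : E) : ip (B := B) (c • x) y = star c • ip x y := by
  rw [← star_ip, ip_smul_right, star_smul, star_ip]

theorem ip_op_smul_left (b : B) (x y : E) : ip (B := B) (op b • x) y = star b * ip x y := by
  rw [← star_ip, ip_op_smul_right, star_mul, star_ip]

theorem ip_zero_right (x : E) : ip (B := B) x 0 = 0 := by
  simpa using ip_smul_right (B := B) (0 : ℂ) x 0

theorem ip_zero_left (x : E) : ip (B := B) 0 x = 0 := by
  rw [← star_ip, ip_zero_right, star_zero]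

theorem ext_ip {x y : E} (h : ∀ z, ip (B := B) z x = ip z y) : x = y := by
  rw [← sub_eq_zero]
  apply eq_zero_of_ip_self (B := B)
  have : x - y = x + (-1 : ℂ) • y := by simp [sub_eq_add_neg]
  conv_lhs => rw [this]
  rw [ip_add_right, ip_smul_right, ← this, h]
  simp

/-- The orthogonal complement `S^⊥` of a submodule. -/
def orth {M : Type*} [AddCommGroup M] [Module ℂ M] [Module Bᵐᵒᵖ M] [InnerProductModule B M]
    (S : Submodule Bᵐᵒᵖ M) : Submodule Bᵐᵒᵖ M where
  carrier := {y | ∀ x ∈ S, ip (B := B) x y = 0}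
  add_mem' := by
    intro a b ha hb x hx
    rw [ip_add_right, ha x hx, hb x hx, add_zero]
  zero_mem' := fun x _ => ip_zero_right B x
  smul_mem' := by
    intro c y hy x hx
    have := ip_op_smul_right c.unop x y
    rw [op_unop, hy x hx, zero_mul] at this
    exact this

end basic

end InnerProductModule

open InnerProductModule

/-- A C⋆-algebra is a Hilbert module over itself, with `⟨a, b⟩ = a⋆ b`. -/
noncomputable instance CStarAlgebra.hilbertModule (B : Type*) [CStarAlgebra B] :
    HilbertModule B B where
  ip a b := star a * b
  ip_add_right := by intros; rw [mul_add]
  ip_smul_right := by intros; rw [mul_smul_comm]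
  ip_op_smul_right := by intros; rw [op_smul_eq_mul, mul_assoc]
  star_ip := by intros; simp
  ip_self_nonneg x := ⟨x, rfl⟩
  eq_zero_of_ip_self x h := by simpa using h
  norm_sq_eq x := by rw [CStarRing.norm_star_mul_self, sq]
  complete := inferInstance

/-! ### The universal representation -/

/-- The positive linear functionals on `B`. -/
abbrev PosFunctional (B : Type*) [CStarAlgebra B] : Type _ :=
  {f : StrongDual ℂ B // ∀ b, 0 ≤ f (star b * b)}

/-- The algebraic direct sum, over all positive functionals `f` on `B`, of copies of `E`. -/
def PreUniv (B E : Type*) [CStarAlgebra B] [AddCommGroup E] : Type _ :=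
  PosFunctional B →₀ E

namespace PreUniv

variable (B E : Type*) [CStarAlgebra B]

noncomputable instance [AddCommGroup E] : AddCommGroup (PreUniv B E) :=
  inferInstanceAs (AddCommGroup (PosFunctional B →₀ E))

noncomputable instance [AddCommGroup E] [Module ℂ E] : Module ℂ (PreUniv B E) :=
  inferInstanceAs (Module ℂ (PosFunctional B →₀ E))

variable {B E}

/-- The underlying finitely supported family. -/
def fam [AddCommGroup E] (x : PreUniv B E) : PosFunctional B →₀ E := x

variable [NormedAddCommGroup E] [NormedSpace ℂ E] [Module Bᵐᵒᵖ E] [HilbertModule B E]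

theorem sum_ip (x y : PreUniv B E) {s : Finset (PosFunctional B)} (hs : x.fam.support ⊆ s) :
    (x.fam.sum fun f e => f.1 (ip e (y.fam f))) = ∑ f ∈ s, f.1 (ip (x.fam f) (y.fam f)) :=
  Finsupp.sum_of_support_subset _ hs _ fun f _ => by rw [ip_zero_left, map_zero]

theorem star_apply (f : PosFunctional B) (b : B) : star (f.1 b) = f.1 (star b) := by
  let _ := CStarAlgebra.spectralOrder B
  let _ := CStarAlgebra.spectralOrderedRing B
  let g : B →ₚ[ℂ] ℂ := PositiveLinearMap.mk₀ f.1.toLinearMap fun a ha => by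
    obtain ⟨c, rfl⟩ := CStarAlgebra.nonneg_iff_eq_star_mul_self.mp ha
    exact f.2 c
  exact (map_star g b).symm

/-- On the `f`-th summand the inner product is `f ⟨x, y⟩`; different summands are orthogonal. -/
noncomputable abbrev core : PreInnerProductSpace.Core ℂ (PreUniv B E) where
  inner x y := x.fam.sum fun f e => f.1 (ip e (y.fam f))
  conj_inner_symm x y := by
    classical
    rw [sum_ip x y (Finset.subset_union_left (s₂ := y.fam.support)),
      sum_ip y x (Finset.subset_union_right (s₁ := x.fam.support)), map_sum]
    refine Finset.sum_congr rfl fun f _ => ?_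
    rw [starRingEnd_apply, star_apply, star_ip]
  re_inner_nonneg x := by
    rw [Finsupp.sum, map_sum]
    refine Finset.sum_nonneg fun f _ => ?_
    obtain ⟨b, hb⟩ := ip_self_nonneg (B := B) (x.fam f)
    rw [hb]
    exact (Complex.le_def.mp (f.2 b)).1
  add_left x y z := by
    exact Finsupp.sum_add_index' (fun f => by rw [ip_zero_left, map_zero])
      (fun f a b => by rw [ip_add_left, map_add])
  smul_left x y c := by
    change (Finsupp.sum (c • x.fam) fun f e => f.1 (ip e (y.fam f))) = _
    rw [Finsupp.sum_smul_index' (fun f => by rw [ip_zero_left, map_zero])]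
    simp only [ip_smul_left, map_smul, smul_eq_mul]
    exact (Finset.mul_sum _ _ _).symm

noncomputable instance : SeminormedAddCommGroup (PreUniv B E) :=
  InnerProductSpace.Core.toSeminormedAddCommGroup (c := core)

noncomputable instance : InnerProductSpace ℂ (PreUniv B E) := InnerProductSpace.ofCore core

theorem inner_def (x y : PreUniv B E) :
    inner ℂ x y = x.fam.sum fun f e => f.1 (ip e (y.fam f)) := rfl

theorem norm_sq_eq (x : PreUniv B E) :
    ‖x‖ ^ 2 = x.fam.sum fun f e => (f.1 (ip e e)).re := by
  rw [← inner_self_eq_norm_sq (𝕜 := ℂ), inner_def, Finsupp.sum, map_sum]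
  rfl

end PreUniv

/-- The Hilbert space `⨁_f E_f`, where `f` runs through the positive functionals on `B` and `E_f`
is the completion of `E` with respect to the inner product `f ⟨x, y⟩`.  For `E = B` this is the
space of the universal representation of `B`, the direct sum of all GNS spaces. -/
def Univ (B E : Type*) [CStarAlgebra B] [NormedAddCommGroup E] [NormedSpace ℂ E]
    [Module Bᵐᵒᵖ E] [HilbertModule B E] : Type _ := Completion (PreUniv B E)

section univ

variable {B E : Type*} [CStarAlgebra B] [NormedAddCommGroup E] [NormedSpace ℂ E]
    [Module Bᵐᵒᵖ E] [HilbertModule B E]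

noncomputable instance : NormedAddCommGroup (Univ B E) :=
  inferInstanceAs (NormedAddCommGroup (Completion (PreUniv B E)))

noncomputable instance : InnerProductSpace ℂ (Univ B E) :=
  inferInstanceAs (InnerProductSpace ℂ (Completion (PreUniv B E)))

instance : CompleteSpace (Univ B E) :=
  inferInstanceAs (CompleteSpace (Completion (PreUniv B E)))

/-- The inclusion of the algebraic direct sum. -/
noncomputable def Univ.mk (x : PreUniv B E) : Univ B E := ((x : PreUniv B E) : Completion _)

theorem Univ.inner_mk (x y : PreUniv B E) : inner ℂ (Univ.mk x) (Univ.mk y) = inner ℂ x y :=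
  Completion.inner_coe x y

theorem Univ.denseRange_mk : DenseRange (Univ.mk : PreUniv B E → Univ B E) :=
  Completion.denseRange_coe

theorem PosFunctional.conj_le (f : PosFunctional B) (e : E) (b : B) :
    (f.1 (star b * ip e e * b)).re ≤ ‖e‖ ^ 2 * (f.1 (star b * b)).re := by
  let _ := CStarAlgebra.spectralOrder B
  let _ := CStarAlgebra.spectralOrderedRing B
  have h1 : star b * ip e e * b ≤ ‖(ip e e : B)‖ • (star b * b) :=
    CStarAlgebra.star_left_conjugate_le_norm_smul (IsSelfAdjoint.star_eq (star_ip e e))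
  obtain ⟨c, hc⟩ := CStarAlgebra.nonneg_iff_eq_star_mul_self.mp (sub_nonneg.mpr h1)
  have h2 := (Complex.le_def.mp (f.2 c)).1
  rw [← hc, map_sub, ← HilbertModule.norm_sq_eq e] at h2
  have h3 : f.1 (‖e‖ ^ 2 • (star b * b)) = ((‖e‖ ^ 2 : ℝ) : ℂ) * f.1 (star b * b) := by
    rw [← Complex.coe_smul, map_smul, smul_eq_mul]
  rw [h3, Complex.sub_re, Complex.re_ofReal_mul] at h2
  simp only [Complex.zero_re] at h2
  linarith

/-- `b ↦ e b` on each summand. -/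
noncomputable def preCreate (e : E) : PreUniv B B →L[ℂ] PreUniv B E :=
  LinearMap.mkContinuous
    (Finsupp.mapRange.linearMap
      { toFun := fun b : B => op b • e
        map_add' := fun x y => by rw [op_add, add_smul]
        map_smul' := fun c x => by
          apply ext_ip B
          intro z
          rw [ip_op_smul_right, RingHom.id_apply, ip_smul_right, ip_op_smul_right, mul_smul_comm] } :
      (PosFunctional B →₀ B) →ₗ[ℂ] (PosFunctional B →₀ E)) ‖e‖ (by
    intro x
    refine (sq_le_sq₀ (norm_nonneg _) (by positivity)).mp ?_
    rw [mul_pow, PreUniv.norm_sq_eq, PreUniv.norm_sq_eq, Finsupp.mul_sum]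
    change (Finsupp.sum (Finsupp.mapRange (fun b : B => op b • e) (by simp) x.fam)
      fun f a => (f.1 (ip a a)).re) ≤ _
    rw [Finsupp.sum_mapRange_index (fun f => by simp [ip_zero_right])]
    refine Finset.sum_le_sum fun f _ => ?_
    beta_reduce
    rw [ip_op_smul_right, ip_op_smul_left]
    exact f.conj_le e _)

theorem preCreate_fam (e : E) (x : PreUniv B B) (f : PosFunctional B) :
    (preCreate e x).fam f = op (x.fam f) • e := rfl

/-- The bounded operator `b ↦ e b` from `⨁_f B_f` to `⨁_f E_f`.  For `E = B` and `e ∈ B` it is the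
operator of `e` in the universal representation of `B`. -/
noncomputable def create (e : E) : Univ B B →L[ℂ] Univ B E :=
  ((preCreate e).completion : Completion (PreUniv B B) →L[ℂ] Completion (PreUniv B E))

theorem create_mk (e : E) (x : PreUniv B B) : create e (Univ.mk x) = Univ.mk (preCreate e x) :=
  (preCreate e).completion_apply_coe x

theorem create_inner (e e' : E) (u v : Univ B B) :
    inner ℂ (create e u) (create (B := B) e' v) = inner ℂ u (create (ip e e' : B) v) := by
  induction u, v using Univ.denseRange_mk.induction_on₂ with
  | hp => apply isClosed_eq <;> fun_prop
  | h u v =>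
    simp only [create_mk, Univ.inner_mk]
    rw [PreUniv.inner_def, PreUniv.inner_def]
    change (Finsupp.sum (Finsupp.mapRange (fun b : B => op b • e) (by simp) u.fam) _) = _
    rw [Finsupp.sum_mapRange_index (fun f => by rw [ip_zero_left, map_zero])]
    refine Finset.sum_congr rfl fun f _ => ?_
    beta_reduce
    rw [preCreate_fam, preCreate_fam, ip_op_smul_left, ip_op_smul_right]
    rfl

theorem create_one : create (1 : B) = ContinuousLinearMap.id ℂ (Univ B B) := by
  refine ContinuousLinearMap.ext fun v => ?_
  induction v using Univ.denseRange_mk.induction_on with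
  | hp => apply isClosed_eq <;> fun_prop
  | ih v =>
    rw [create_mk]
    change _ = Univ.mk v
    congr 1
    refine Finsupp.ext fun f => ?_
    exact one_mul _

theorem create_comp (e : E) (b : B) (v : Univ B B) :
    create e (create b v) = create (B := B) (op b • e) v := by
  induction v using Univ.denseRange_mk.induction_on with
  | hp => apply isClosed_eq <;> fun_prop
  | ih v =>
    simp only [create_mk]
    congr 1
    refine Finsupp.ext fun f => ?_
    change op (op (v.fam f) • b) • e = op (v.fam f) • op b • e
    rw [smul_smul]; rfl

end univ

/-! ### Hilbert modules of operators -/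

section operators

variable {K L : Type*} [NormedAddCommGroup K] [InnerProductSpace ℂ K] [CompleteSpace K]
  [NormedAddCommGroup L] [InnerProductSpace ℂ L] [CompleteSpace L]

/-- Right multiplication by the operators in `D` on a space of operators. -/
@[reducible]
noncomputable def operatorModule (D : StarSubalgebra ℂ (K →L[ℂ] K)) (S : Submodule ℂ (K →L[ℂ] L))
    (h : ∀ u ∈ S, ∀ d ∈ D, u ∘L d ∈ S) : Module (D)ᵐᵒᵖ S where
  smul d u := ⟨u.1 ∘L d.unop.1, h u.1 u.2 d.unop.1 d.unop.2⟩
  one_smul _ := Subtype.ext (ContinuousLinearMap.ext fun _ => rfl)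
  mul_smul _ _ _ := Subtype.ext (ContinuousLinearMap.ext fun _ => rfl)
  smul_zero _ := Subtype.ext (ContinuousLinearMap.zero_comp _)
  smul_add _ _ _ := Subtype.ext (ContinuousLinearMap.add_comp _ _ _)
  add_smul _ _ _ := Subtype.ext (ContinuousLinearMap.comp_add _ _ _)
  zero_smul _ := Subtype.ext (ContinuousLinearMap.comp_zero _)

theorem adjoint_comp_self_eq (D : StarSubalgebra ℂ (K →L[ℂ] K))
    [hD : IsClosed (D : Set (K →L[ℂ] K))] (u : K →L[ℂ] L) (hu : u.adjoint ∘L u ∈ D) :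
    ∃ d : D, (⟨u.adjoint ∘L u, hu⟩ : D) = star d * d := by
  let _ := CStarAlgebra.spectralOrder D
  let _ := CStarAlgebra.spectralOrderedRing D
  refine CStarAlgebra.nonneg_iff_eq_star_mul_self.mp ?_
  have hsa : IsSelfAdjoint (⟨u.adjoint ∘L u, hu⟩ : D) := Subtype.ext (by
    change ContinuousLinearMap.adjoint (u.adjoint ∘L u) = u.adjoint ∘L u
    rw [ContinuousLinearMap.adjoint_comp, ContinuousLinearMap.adjoint_adjoint])
  have hpos : (0 : K →L[ℂ] K) ≤ u.adjoint ∘L u := by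
    rw [ContinuousLinearMap.nonneg_iff_isPositive]
    exact ContinuousLinearMap.isPositive_adjoint_comp_self u
  rw [StarOrderedRing.nonneg_iff_spectrum_nonneg (R := ℝ) _ hsa]
  intro x hx
  have hx' : (algebraMap ℝ ℂ x) ∈ spectrum ℂ (⟨u.adjoint ∘L u, hu⟩ : D) :=
    (spectrum.algebraMap_mem_iff ℂ).mpr hx
  rw [StarSubalgebra.spectrum_eq] at hx'
  exact spectrum_nonneg_of_nonneg (𝕜 := ℝ) hpos ((spectrum.algebraMap_mem_iff ℂ).mp hx')

theorem comp_mem_closure_span {S : Set (K →L[ℂ] L)} {T : Set (K →L[ℂ] K)}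
    (hT : ∀ t ∈ T, t.adjoint ∈ T) (hST : ∀ s ∈ S, ∀ t ∈ T, s ∘L t ∈ S) :
    ∀ u ∈ (Submodule.span ℂ S).topologicalClosure,
      ∀ d ∈ (StarAlgebra.adjoin ℂ T).topologicalClosure,
        u ∘L d ∈ (Submodule.span ℂ S).topologicalClosure := by
  set V := (Submodule.span ℂ S).topologicalClosure with hV
  have hVc : IsClosed (V : Set (K →L[ℂ] L)) := Submodule.isClosed_topologicalClosure _
  have h1 : ∀ t ∈ T, ∀ u ∈ V, u ∘L t ∈ V := by
    intro t ht u hu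
    let R : (K →L[ℂ] L) →ₗ[ℂ] (K →L[ℂ] L) :=
      { toFun := fun u => u ∘L t
        map_add' := fun _ _ => ContinuousLinearMap.add_comp _ _ _
        map_smul' := fun _ _ => ContinuousLinearMap.smul_comp _ _ _ }
    have hR : Continuous fun u : K →L[ℂ] L => u ∘L t := continuous_id.clm_comp continuous_const
    have hle : V ≤ V.comap R := by
      refine Submodule.topologicalClosure_minimal _ ?_ (hVc.preimage hR)
      refine Submodule.span_le.mpr fun s hs => ?_
      exact Submodule.le_topologicalClosure _ (Submodule.subset_span (hST s hs t ht))
    exact hle hu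
  have h2 : ∀ d ∈ StarAlgebra.adjoin ℂ T, ∀ u ∈ V, u ∘L d ∈ V := by
    intro d hd
    have hst : star T ⊆ T := fun t ht => by
      have := hT _ ht
      rwa [← ContinuousLinearMap.star_eq_adjoint, star_star] at this
    have hd' : d ∈ Algebra.adjoin ℂ T := by
      have : d ∈ (StarAlgebra.adjoin ℂ T).toSubalgebra := hd
      rwa [StarAlgebra.adjoin_toSubalgebra, Set.union_eq_self_of_subset_right hst] at this
    clear hd
    induction hd' using Algebra.adjoin_induction with
    | mem t ht => exact h1 t ht
    | algebraMap r =>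
      intro u hu
      convert V.smul_mem r hu using 1
      ext x
      simp [Algebra.algebraMap_eq_smul_one]
    | add x y _ _ ihx ihy =>
      intro u hu
      rw [ContinuousLinearMap.comp_add]
      exact V.add_mem (ihx u hu) (ihy u hu)
    | mul x y _ _ ihx ihy =>
      intro u hu
      exact ihy _ (ihx u hu)
  intro u hu d hd
  have hL : Continuous fun d : K →L[ℂ] K => u ∘L d := continuous_const.clm_comp continuous_id
  have : closure (StarAlgebra.adjoin ℂ T : Set (K →L[ℂ] K)) ⊆ (fun d => u ∘L d) ⁻¹' V :=
    closure_minimal (fun d hd => h2 d hd u hu) (hVc.preimage hL)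
  exact this hd

theorem adjoint_comp_mem_closure_span {S : Set (K →L[ℂ] L)} {T : Set (K →L[ℂ] K)}
    (hST : ∀ s ∈ S, ∀ s' ∈ S, s.adjoint ∘L s' ∈ T) :
    ∀ u ∈ (Submodule.span ℂ S).topologicalClosure,
      ∀ v ∈ (Submodule.span ℂ S).topologicalClosure,
        u.adjoint ∘L v ∈ (StarAlgebra.adjoin ℂ T).topologicalClosure := by
  set D := (StarAlgebra.adjoin ℂ T).topologicalClosure with hDdef
  have hDc : IsClosed (D : Set (K →L[ℂ] K)) := StarSubalgebra.isClosed_topologicalClosure _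
  have key : ∀ u : K →L[ℂ] L, (∀ s ∈ S, u.adjoint ∘L s ∈ D) →
      ∀ v ∈ (Submodule.span ℂ S).topologicalClosure, u.adjoint ∘L v ∈ D := by
    intro u hu v hv
    have hL : Continuous fun v : K →L[ℂ] L => u.adjoint ∘L v :=
      continuous_const.clm_comp continuous_id
    have : closure (Submodule.span ℂ S : Set (K →L[ℂ] L)) ⊆ (fun v => u.adjoint ∘L v) ⁻¹' D := by
      refine closure_minimal (fun v hv => ?_) (hDc.preimage hL)
      change u.adjoint ∘L v ∈ D
      induction hv using Submodule.span_induction with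
      | mem s hs => exact hu s hs
      | zero => rw [ContinuousLinearMap.comp_zero]; exact zero_mem D
      | add x y _ _ hx hy => rw [ContinuousLinearMap.comp_add]; exact add_mem hx hy
      | smul c x _ hx => rw [ContinuousLinearMap.comp_smul]; exact D.smul_mem hx c
    exact this hv
  have flip : ∀ u v : K →L[ℂ] L, u.adjoint ∘L v ∈ D → v.adjoint ∘L u ∈ D := by
    intro u v h
    have := star_mem h
    rwa [ContinuousLinearMap.star_eq_adjoint, ContinuousLinearMap.adjoint_comp,
      ContinuousLinearMap.adjoint_adjoint] at this
  intro u hu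
  refine key u fun s hs => flip s u (key s (fun s' hs' => ?_) u hu)
  exact StarSubalgebra.le_topologicalClosure _ (StarAlgebra.subset_adjoin ℂ _ (hST s hs s' hs'))
/-- A closed space `S` of operators from `K` to `L` with `S D ⊆ S` and `S⋆ S ⊆ D` is a Hilbert
`D`-module, with `⟨u, v⟩ = u⋆ v`. -/
@[reducible]
noncomputable def operatorHilbertModule (D : StarSubalgebra ℂ (K →L[ℂ] K))
    [hD : IsClosed (D : Set (K →L[ℂ] K))] (S : Submodule ℂ (K →L[ℂ] L))
    (hS : IsClosed (S : Set (K →L[ℂ] L)))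
    (h : ∀ u ∈ S, ∀ d ∈ D, u ∘L d ∈ S) (h' : ∀ u ∈ S, ∀ v ∈ S, u.adjoint ∘L v ∈ D) :
    @HilbertModule D S _ _ _ (operatorModule D S h) :=
  letI := operatorModule D S h
  { ip := fun u v => ⟨u.1.adjoint ∘L v.1, h' u.1 u.2 v.1 v.2⟩
    ip_add_right := fun x y z => Subtype.ext (ContinuousLinearMap.comp_add _ _ _)
    ip_smul_right := fun c x y => Subtype.ext (ContinuousLinearMap.comp_smul _ _ _)
    ip_op_smul_right := fun b x y => Subtype.ext (ContinuousLinearMap.ext fun _ => rfl)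
    star_ip := fun x y => Subtype.ext (by
      change ContinuousLinearMap.adjoint (x.1.adjoint ∘L y.1) = y.1.adjoint ∘L x.1
      rw [ContinuousLinearMap.adjoint_comp, ContinuousLinearMap.adjoint_adjoint])
    ip_self_nonneg := fun x => adjoint_comp_self_eq D x.1 _
    eq_zero_of_ip_self := fun x hx => by
      have h1 : ‖x.1.adjoint ∘L x.1‖ = 0 := by
        rw [show x.1.adjoint ∘L x.1 = 0 from congrArg Subtype.val hx, norm_zero]
      rw [ContinuousLinearMap.norm_adjoint_comp_self] at h1
      exact norm_eq_zero.mp (mul_self_eq_zero.mp h1)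
    norm_sq_eq := fun x => by
      rw [sq]
      exact (ContinuousLinearMap.norm_adjoint_comp_self x.1).symm
    complete := hS.completeSpace_coe }

end operators

/-! ### Exterior tensor products -/

section tensor

variable {B C E G : Type*} [CStarAlgebra B] [CStarAlgebra C]
  [NormedAddCommGroup E] [NormedSpace ℂ E] [Module Bᵐᵒᵖ E] [HilbertModule B E]
  [NormedAddCommGroup G] [NormedSpace ℂ G] [Module Cᵐᵒᵖ G] [HilbertModule C G]

/-- The Hilbert space tensor product `(⨁_f E_f) ⊗ (⨁_g G_g)`. -/
def UnivTensor (B C E G : Type*) [CStarAlgebra B] [CStarAlgebra C]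
    [NormedAddCommGroup E] [NormedSpace ℂ E] [Module Bᵐᵒᵖ E] [HilbertModule B E]
    [NormedAddCommGroup G] [NormedSpace ℂ G] [Module Cᵐᵒᵖ G] [HilbertModule C G] : Type _ :=
  Completion (Univ B E ⊗[ℂ] Univ C G)

noncomputable instance : NormedAddCommGroup (UnivTensor B C E G) :=
  inferInstanceAs (NormedAddCommGroup (Completion (Univ B E ⊗[ℂ] Univ C G)))

noncomputable instance : InnerProductSpace ℂ (UnivTensor B C E G) :=
  inferInstanceAs (InnerProductSpace ℂ (Completion (Univ B E ⊗[ℂ] Univ C G)))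

instance : CompleteSpace (UnivTensor B C E G) :=
  inferInstanceAs (CompleteSpace (Completion (Univ B E ⊗[ℂ] Univ C G)))

/-- The inclusion of the algebraic tensor product. -/
noncomputable def UnivTensor.mk (x : Univ B E ⊗[ℂ] Univ C G) : UnivTensor B C E G :=
  (x : Completion _)

theorem UnivTensor.inner_mk (x y : Univ B E ⊗[ℂ] Univ C G) :
    inner ℂ (UnivTensor.mk x) (UnivTensor.mk y) = inner ℂ x y :=
  Completion.inner_coe x y

theorem UnivTensor.denseRange_mk :
    DenseRange (UnivTensor.mk : Univ B E ⊗[ℂ] Univ C G → UnivTensor B C E G) :=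
  Completion.denseRange_coe

/-- The operator `e ⊗ g` from `(⨁_f B_f) ⊗ (⨁_g C_g)` to `(⨁_f E_f) ⊗ (⨁_g G_g)`, the tensor
product of the operators of `e` and `g`. -/
noncomputable def createTensor (e : E) (g : G) :
    UnivTensor B C B C →L[ℂ] UnivTensor B C E G :=
  ((TensorProduct.mapL (create (B := B) e) (create (B := C) g)).completion :
    Completion (Univ B B ⊗[ℂ] Univ C C) →L[ℂ] Completion (Univ B E ⊗[ℂ] Univ C G))

theorem createTensor_mk (e : E) (g : G) (x : Univ B B ⊗[ℂ] Univ C C) :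
    createTensor e g (UnivTensor.mk x) =
      UnivTensor.mk (TensorProduct.mapL (create (B := B) e) (create (B := C) g) x) :=
  ContinuousLinearMap.completion_apply_coe _ x

theorem createTensor_inner (e e' : E) (g g' : G) (u v : UnivTensor B C B C) :
    inner ℂ (createTensor e g u) (createTensor e' g' v) =
      inner ℂ u (createTensor (ip e e' : B) (ip g g' : C) v) := by
  induction u, v using UnivTensor.denseRange_mk.induction_on₂ with
  | hp => apply isClosed_eq <;> fun_prop
  | h u v =>
    simp only [createTensor_mk, UnivTensor.inner_mk]
    induction u with
    | zero => simp
    | add x y hx hy => rw [map_add, inner_add_left, hx, hy, inner_add_left]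
    | tmul a b =>
      induction v with
      | zero => simp
      | add x y hx hy => rw [map_add, inner_add_right, hx, hy, map_add, inner_add_right]
      | tmul c d =>
        simp only [TensorProduct.mapL_tmul, TensorProduct.inner_tmul, create_inner]

theorem adjoint_createTensor_comp (e e' : E) (g g' : G) :
    (createTensor (B := B) (C := C) e g).adjoint ∘L createTensor e' g' =
      createTensor (ip e e' : B) (ip g g' : C) := by
  refine ContinuousLinearMap.ext fun v => ext_inner_left ℂ fun u => ?_
  rw [ContinuousLinearMap.comp_apply, ContinuousLinearMap.adjoint_inner_right,
    createTensor_inner]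

theorem createTensor_comp (e : E) (g : G) (b : B) (c : C) :
    createTensor e g ∘L createTensor b c = createTensor (B := B) (C := C) (op b • e) (op c • g) := by
  refine ContinuousLinearMap.ext fun v => ?_
  induction v using UnivTensor.denseRange_mk.induction_on with
  | hp => apply isClosed_eq <;> fun_prop
  | ih v =>
    simp only [createTensor_mk, ContinuousLinearMap.comp_apply]
    congr 1
    induction v with
    | zero => simp
    | add x y hx hy => simp only [map_add, hx, hy]
    | tmul a d => simp only [TensorProduct.mapL_tmul, create_comp]

/-- The operators in the minimal tensor product: the C⋆-algebra generated by the operators `b ⊗ c`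
in the tensor product of the universal representations of `B` and `C`. -/
noncomputable def minTensorAlg (B C : Type*) [CStarAlgebra B] [CStarAlgebra C] :
    StarSubalgebra ℂ (UnivTensor B C B C →L[ℂ] UnivTensor B C B C) :=
  (StarAlgebra.adjoin ℂ
    (Set.range fun p : B × C => createTensor (B := B) (C := C) p.1 p.2)).topologicalClosure

instance minTensorAlg_isClosed (B C : Type*) [CStarAlgebra B] [CStarAlgebra C] :
    IsClosed (minTensorAlg B C :
      Set (UnivTensor B C B C →L[ℂ] UnivTensor B C B C)) :=
  StarSubalgebra.isClosed_topologicalClosure _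

/-- The minimal (spatial) tensor product `B ⊗ C` of C⋆-algebras. -/
def MinTensor (B C : Type*) [CStarAlgebra B] [CStarAlgebra C] : Type _ := minTensorAlg B C

noncomputable instance (B C : Type*) [CStarAlgebra B] [CStarAlgebra C] :
    CStarAlgebra (MinTensor B C) :=
  inferInstanceAs (CStarAlgebra (minTensorAlg B C))

theorem createTensor_mem_minTensorAlg (b : B) (c : C) :
    createTensor (B := B) (C := C) b c ∈ minTensorAlg B C :=
  StarSubalgebra.le_topologicalClosure _ (StarAlgebra.subset_adjoin ℂ _ ⟨(b, c), rfl⟩)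

/-- The elementary tensor `b ⊗ c` in `B ⊗ C`. -/
noncomputable def MinTensor.tmul (b : B) (c : C) : MinTensor B C :=
  ⟨createTensor b c, createTensor_mem_minTensorAlg b c⟩

/-- The closed linear span of the operators `e ⊗ g`. -/
noncomputable def extTensorSub (B C E G : Type*) [CStarAlgebra B] [CStarAlgebra C]
    [NormedAddCommGroup E] [NormedSpace ℂ E] [Module Bᵐᵒᵖ E] [HilbertModule B E]
    [NormedAddCommGroup G] [NormedSpace ℂ G] [Module Cᵐᵒᵖ G] [HilbertModule C G] :
    Submodule ℂ (UnivTensor B C B C →L[ℂ] UnivTensor B C E G) :=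
  (Submodule.span ℂ
    (Set.range fun p : E × G => createTensor (B := B) (C := C) p.1 p.2)).topologicalClosure

theorem createTensor_mem_extTensorSub (e : E) (g : G) :
    createTensor e g ∈ extTensorSub B C E G :=
  Submodule.le_topologicalClosure _ (Submodule.subset_span ⟨(e, g), rfl⟩)

theorem isClosed_extTensorSub : IsClosed (extTensorSub B C E G :
    Set (UnivTensor B C B C →L[ℂ] UnivTensor B C E G)) :=
  Submodule.isClosed_topologicalClosure _

theorem createTensor_one_one :
    createTensor (1 : B) (1 : C) = ContinuousLinearMap.id ℂ (UnivTensor B C B C) := by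
  refine ContinuousLinearMap.ext fun v => ext_inner_left ℂ fun u => ?_
  obtain ⟨w, rfl⟩ : ∃ w, w = v := ⟨v, rfl⟩
  have key : ∀ x : Univ B B ⊗[ℂ] Univ C C,
      TensorProduct.mapL (create (B := B) (1 : B)) (create (B := C) (1 : C)) x = x := by
    intro x
    rw [create_one, create_one, TensorProduct.mapL_id_id]; rfl
  induction w using UnivTensor.denseRange_mk.induction_on with
  | hp => apply isClosed_eq <;> fun_prop
  | ih x => rw [createTensor_mk, key]; rfl

theorem adjoint_createTensor (b : B) (c : C) :
    (createTensor (B := B) (C := C) b c).adjoint = createTensor (star b) (star c) := by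
  have h := adjoint_createTensor_comp (B := B) (C := C) b 1 c 1
  rw [createTensor_one_one, ContinuousLinearMap.comp_id] at h
  rw [h]
  congr 1 <;> exact mul_one _

theorem extTensorSub_comp_mem : ∀ u ∈ extTensorSub B C E G, ∀ d ∈ minTensorAlg B C,
    u ∘L d ∈ extTensorSub B C E G := by
  refine comp_mem_closure_span ?_ ?_
  · rintro _ ⟨p, rfl⟩
    exact ⟨(star p.1, star p.2), (adjoint_createTensor p.1 p.2).symm⟩
  · rintro _ ⟨p, rfl⟩ _ ⟨q, rfl⟩
    exact ⟨(op q.1 • p.1, op q.2 • p.2), (createTensor_comp p.1 p.2 q.1 q.2).symm⟩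

theorem adjoint_comp_mem : ∀ u ∈ extTensorSub B C E G, ∀ v ∈ extTensorSub B C E G,
    u.adjoint ∘L v ∈ minTensorAlg B C := by
  refine adjoint_comp_mem_closure_span ?_
  rintro _ ⟨p, rfl⟩ _ ⟨q, rfl⟩
  exact ⟨(ip p.1 q.1, ip p.2 q.2), (adjoint_createTensor_comp p.1 q.1 p.2 q.2).symm⟩

/-- The exterior tensor product `E ⊗ G` of a Hilbert `B`-module and a Hilbert `C`-module.  The
`B ⊗ C`-valued inner product is `⟨u, v⟩ = u⋆ v`, the right action of `B ⊗ C` is composition;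
thus `⟨e ⊗ g, e' ⊗ g'⟩ = ⟨e, e'⟩ ⊗ ⟨g, g'⟩` and `(e ⊗ g) (b ⊗ c) = (e b) ⊗ (g c)`, and the linear
combinations of the `e ⊗ g` are dense. -/
def ExtTensor (B C E G : Type*) [CStarAlgebra B] [CStarAlgebra C]
    [NormedAddCommGroup E] [NormedSpace ℂ E] [Module Bᵐᵒᵖ E] [HilbertModule B E]
    [NormedAddCommGroup G] [NormedSpace ℂ G] [Module Cᵐᵒᵖ G] [HilbertModule C G] : Type _ :=
  extTensorSub B C E G

noncomputable instance : NormedAddCommGroup (ExtTensor B C E G) :=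
  inferInstanceAs (NormedAddCommGroup (extTensorSub B C E G))

noncomputable instance : NormedSpace ℂ (ExtTensor B C E G) :=
  inferInstanceAs (NormedSpace ℂ (extTensorSub B C E G))

noncomputable instance : Module (MinTensor B C)ᵐᵒᵖ (ExtTensor B C E G) :=
  operatorModule (minTensorAlg B C) (extTensorSub B C E G) extTensorSub_comp_mem

noncomputable instance : HilbertModule (MinTensor B C) (ExtTensor B C E G) :=
  operatorHilbertModule (minTensorAlg B C) (extTensorSub B C E G) isClosed_extTensorSub
    extTensorSub_comp_mem adjoint_comp_mem

/-- The elementary tensor `e ⊗ g` in `E ⊗ G`. -/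
noncomputable def ExtTensor.tmul (B C : Type*) {E G : Type*} [CStarAlgebra B] [CStarAlgebra C]
    [NormedAddCommGroup E] [NormedSpace ℂ E] [Module Bᵐᵒᵖ E] [HilbertModule B E]
    [NormedAddCommGroup G] [NormedSpace ℂ G] [Module Cᵐᵒᵖ G] [HilbertModule C G]
    (e : E) (g : G) : ExtTensor B C E G :=
  ⟨createTensor e g, createTensor_mem_extTensorSub e g⟩

theorem ExtTensor.ip_tmul (e e' : E) (g g' : G) :
    ip (tmul B C e g) (tmul B C e' g') = MinTensor.tmul (ip e e' : B) (ip g g' : C) :=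
  Subtype.ext (adjoint_createTensor_comp e e' g g')

theorem ExtTensor.op_smul_tmul (e : E) (g : G) (b : B) (c : C) :
    op (MinTensor.tmul b c) • tmul B C e g = tmul B C (op b • e) (op c • g) :=
  Subtype.ext (createTensor_comp e g b c)

end tensor

/-! ### Pettis integrals -/

section pettis

variable {X : Type*} [MeasurableSpace X]

/-- `k` is Pettis integrable: every `φ ∘ k` with `φ` in the dual space is integrable, and every
measurable set `s` has an integral `v` in the space itself, `φ v = ∫_s φ (k x)` for all `φ`. -/
structure PettisIntegrable {V : Type*} [NormedAddCommGroup V] [NormedSpace ℂ V]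
    (μ : Measure X) (k : X → V) : Prop where
  integrable : ∀ φ : StrongDual ℂ V, Integrable (fun x => φ (k x)) μ
  exists_integral : ∀ s, MeasurableSet s →
    ∃ v : V, ∀ φ : StrongDual ℂ V, φ v = ∫ x in s, φ (k x) ∂μ

open Classical in
/-- The Pettis integral of `k`, the vector `v` with `φ v = ∫ φ (k x)` for all `φ` in the dual space
(and `0` if `k` is not Pettis integrable). -/
noncomputable def pettisIntegral {V : Type*} [NormedAddCommGroup V] [NormedSpace ℂ V]
    (μ : Measure X) (k : X → V) : V :=
  if h : PettisIntegrable μ k then (h.exists_integral Set.univ MeasurableSet.univ).choose else 0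

variable {μ : Measure X} {V W : Type*} [NormedAddCommGroup V] [NormedSpace ℂ V]
  [NormedAddCommGroup W] [NormedSpace ℂ W]

theorem eq_of_forall_dual {v w : V} (h : ∀ φ : StrongDual ℂ V, φ v = φ w) : v = w := by
  refine sub_eq_zero.mp (SeparatingDual.eq_zero_of_forall_dual_eq_zero (R := ℂ) fun φ => ?_)
  rw [map_sub, h, sub_self]

theorem PettisIntegrable.apply_integral {k : X → V} (h : PettisIntegrable μ k)
    (φ : StrongDual ℂ V) : φ (pettisIntegral μ k) = ∫ x, φ (k x) ∂μ := by
  rw [pettisIntegral, dif_pos h, (h.exists_integral Set.univ MeasurableSet.univ).choose_spec φ,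
    setIntegral_univ]

theorem PettisIntegrable.integral_eq {k : X → V} (h : PettisIntegrable μ k) {v : V}
    (hv : ∀ φ : StrongDual ℂ V, φ v = ∫ x, φ (k x) ∂μ) : pettisIntegral μ k = v :=
  eq_of_forall_dual fun φ => by rw [h.apply_integral, hv]

theorem PettisIntegrable.congr {k l : X → V} (h : PettisIntegrable μ k) (hkl : k =ᵐ[μ] l) :
    PettisIntegrable μ l where
  integrable φ := (h.integrable φ).congr (hkl.fun_comp φ)
  exists_integral s hs := by
    obtain ⟨v, hv⟩ := h.exists_integral s hs
    exact ⟨v, fun φ => (hv φ).trans (integral_congr_ae (ae_restrict_of_ae (hkl.fun_comp φ)))⟩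

theorem pettisIntegral_congr {k l : X → V} (hkl : k =ᵐ[μ] l) :
    pettisIntegral μ k = pettisIntegral μ l := by
  by_cases h : PettisIntegrable μ k
  · refine h.integral_eq fun φ => ?_
    rw [(h.congr hkl).apply_integral]
    exact integral_congr_ae (hkl.symm.fun_comp φ)
  · have h' : ¬ PettisIntegrable μ l := fun h' => h (h'.congr hkl.symm)
    rw [pettisIntegral, pettisIntegral, dif_neg h, dif_neg h']

theorem PettisIntegrable.add {k l : X → V} (hk : PettisIntegrable μ k)
    (hl : PettisIntegrable μ l) : PettisIntegrable μ (fun x => k x + l x) where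
  integrable φ := by
    simp only [map_add]
    exact (hk.integrable φ).add (hl.integrable φ)
  exists_integral s hs := by
    obtain ⟨v, hv⟩ := hk.exists_integral s hs
    obtain ⟨w, hw⟩ := hl.exists_integral s hs
    refine ⟨v + w, fun φ => ?_⟩
    simp only [map_add]
    rw [hv, hw, integral_add (hk.integrable φ).restrict (hl.integrable φ).restrict]

theorem PettisIntegrable.clm {k : X → V} (hk : PettisIntegrable μ k) (T : V →L[ℂ] W) :
    PettisIntegrable μ (fun x => T (k x)) where
  integrable φ := hk.integrable (φ ∘L T)
  exists_integral s hs := by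
    obtain ⟨v, hv⟩ := hk.exists_integral s hs
    exact ⟨T v, fun φ => hv (φ ∘L T)⟩

theorem pettisIntegral_add {k l : X → V} (hk : PettisIntegrable μ k)
    (hl : PettisIntegrable μ l) :
    pettisIntegral μ (fun x => k x + l x) = pettisIntegral μ k + pettisIntegral μ l :=
  (hk.add hl).integral_eq fun φ => by
    simp only [map_add]
    rw [hk.apply_integral, hl.apply_integral, integral_add (hk.integrable φ) (hl.integrable φ)]

theorem pettisIntegral_clm {k : X → V} (hk : PettisIntegrable μ k) (T : V →L[ℂ] W) :
    pettisIntegral μ (fun x => T (k x)) = T (pettisIntegral μ k) :=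
  (hk.clm T).integral_eq fun φ => hk.apply_integral (φ ∘L T)

/-! #### Positive functions with values in a C⋆-algebra -/

variable {D : Type*} [CStarAlgebra D]

section order
variable [PartialOrder D] [StarOrderedRing D]

/-- A weak integral of a positive function is positive. -/
theorem nonneg_of_weak_integral {k : X → D} {s : Set X} {v : D}
    (hv : ∀ φ : StrongDual ℂ D, φ v = ∫ x in s, φ (k x) ∂μ)
    (hi : ∀ φ : StrongDual ℂ D, IntegrableOn (fun x => φ (k x)) s μ)
    (hk : ∀ x, 0 ≤ k x) : 0 ≤ v := by
  by_contra hneg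
  have hconv : Convex ℝ {a : D | 0 ≤ a} := convex_Ici 0
  obtain ⟨φ, u, hu1, hu2⟩ := RCLike.geometric_hahn_banach_closed_point (𝕜 := ℂ) hconv
    CStarAlgebra.isClosed_nonneg (x := v) hneg
  have hu0 : 0 < u := by simpa using hu1 0 le_rfl
  have hle : ∀ a : D, 0 ≤ a → (φ a).re ≤ 0 := by
    intro a ha
    by_contra hpos
    push Not at hpos
    have h1 := hu1 ((u / (φ a).re) • a) (smul_nonneg (by positivity) ha)
    have h2 : φ ((u / (φ a).re) • a) = ((u / (φ a).re : ℝ) : ℂ) * φ a := by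
      rw [← Complex.coe_smul, map_smul, smul_eq_mul]
    rw [h2] at h1
    simp only [RCLike.re_eq_complex_re, Complex.re_ofReal_mul] at h1
    rw [div_mul_cancel₀ _ hpos.ne'] at h1
    exact lt_irrefl _ h1
  have h3 : (φ v).re = ∫ x in s, (φ (k x)).re ∂μ := by
    rw [hv φ]
    exact (integral_re (hi φ)).symm
  have h4 : (∫ x in s, (φ (k x)).re ∂μ) ≤ 0 := integral_nonpos fun x => hle _ (hk x)
  simp only [RCLike.re_eq_complex_re] at hu2
  linarith

/-- The integrals of a positive Pettis integrable function over sets decreasing to the empty set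
tend to zero in norm. -/
theorem exists_weak_integral_lt {l : X → D} (hl : PettisIntegrable μ l) (hl0 : ∀ x, 0 ≤ l x)
    {A : ℕ → Set X} (hA : ∀ n, MeasurableSet (A n)) (hanti : Antitone A)
    (hempty : ⋂ n, A n = ∅) {ε : ℝ} (hε : 0 < ε) :
    ∃ n, ∀ s, MeasurableSet s → s ⊆ A n → ∀ v : D,
      (∀ φ : StrongDual ℂ D, φ v = ∫ x in s, φ (l x) ∂μ) → ‖v‖ < ε := by
  choose ν hν using hl.exists_integral
  have mono : ∀ s t (hs : MeasurableSet s) (ht : MeasurableSet t), s ⊆ t → ν s hs ≤ ν t ht := by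
    intro s t hs ht hst
    rw [← sub_nonneg]
    refine nonneg_of_weak_integral (μ := μ) (k := l) (s := t \ s) (fun φ => ?_)
      (fun φ => (hl.integrable φ).integrableOn) hl0
    rw [map_sub, hν, hν, setIntegral_sdiff hs (hl.integrable φ).integrableOn hst]
  have pos : ∀ s (hs : MeasurableSet s), 0 ≤ ν s hs := fun s hs =>
    nonneg_of_weak_integral (hν s hs) (fun φ => (hl.integrable φ).integrableOn) hl0
  -- some `ν (A n)` is small
  have main : ∃ n, ‖ν (A n) (hA n)‖ < ε := by
    by_contra! hcon
    let P : Set D := {a | ∃ n, ν (A n) (hA n) ≤ a}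
    have hP : Convex ℝ P := by
      rintro a ⟨n, hn⟩ b ⟨m, hm⟩ p q hp hq hpq
      refine ⟨max n m, ?_⟩
      have h1 := (mono _ _ (hA (max n m)) (hA n) (hanti (le_max_left n m))).trans hn
      have h2 := (mono _ _ (hA (max n m)) (hA m) (hanti (le_max_right n m))).trans hm
      exact (convex_Ici (ν (A (max n m)) (hA (max n m)))) h1 h2 hp hq hpq
    have h0 : (0 : D) ∉ closure P := by
      intro h0
      obtain ⟨a, ⟨n, hn⟩, ha⟩ := Metric.mem_closure_iff.mp h0 ε hε
      rw [dist_zero_left] at ha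
      exact absurd ((CStarAlgebra.norm_le_norm_of_nonneg_of_le (pos _ (hA n)) hn).trans_lt ha)
        (not_lt.mpr (hcon n))
    obtain ⟨φ, u, hu1, hu2⟩ := RCLike.geometric_hahn_banach_point_closed (𝕜 := ℂ) hP.closure
      isClosed_closure h0
    have hlim : Filter.Tendsto (fun n => ∫ x in A n, φ (l x) ∂μ) Filter.atTop (nhds 0) := by
      have := tendsto_setIntegral_of_antitone (μ := μ) (f := fun x => φ (l x)) hA hanti
        ⟨0, (hl.integrable φ).integrableOn⟩
      rwa [hempty, setIntegral_empty] at this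
    have hlim' : Filter.Tendsto (fun n => (φ (ν (A n) (hA n))).re) Filter.atTop (nhds 0) := by
      have := (Complex.continuous_re.tendsto 0).comp hlim
      simpa [Function.comp_def, hν] using this
    have := ge_of_tendsto' hlim' fun n => (hu2 _ (subset_closure ⟨n, le_rfl⟩)).le
    simp at hu1
    linarith
  obtain ⟨n, hn⟩ := main
  refine ⟨n, fun s hs hsA v hv => ?_⟩
  have hv' : v = ν s hs := eq_of_forall_dual fun φ => by rw [hv, hν]
  rw [hv']
  exact (CStarAlgebra.norm_le_norm_of_nonneg_of_le (pos s hs) (mono s _ hs (hA n) hsA)).trans_lt hn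

/-- A strongly measurable positive function dominated by a Pettis integrable one is Pettis
integrable. -/
theorem PettisIntegrable.of_le [IsFiniteMeasure μ] {k l : X → D} (hl : PettisIntegrable μ l)
    (hkm : StronglyMeasurable k) (hk0 : ∀ x, 0 ≤ k x) (hkl : ∀ x, k x ≤ l x) :
    PettisIntegrable μ k := by
  have hl0 : ∀ x, 0 ≤ l x := fun x => (hk0 x).trans (hkl x)
  choose ν hν using hl.exists_integral
  let A : ℕ → Set X := fun n => {x | ‖k x‖ ≤ n}
  have hA : ∀ n, MeasurableSet (A n) := fun n =>
    measurableSet_le hkm.norm.measurable measurable_const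
  have hAmono : Monotone A := fun n m hnm x (hx : ‖k x‖ ≤ n) =>
    hx.trans (by exact_mod_cast hnm)
  have hAuniv : ⋃ n, A n = Set.univ := Set.eq_univ_of_forall fun x =>
    Set.mem_iUnion.mpr (exists_nat_ge ‖k x‖)
  have hint : ∀ n, IntegrableOn k (A n) μ := fun n =>
    Measure.integrableOn_of_bounded (M := n) (measure_ne_top _ _) hkm.aestronglyMeasurable
      ((ae_restrict_iff' (hA n)).mpr (Filter.Eventually.of_forall fun x hx => hx))
  have bochner : ∀ s n, MeasurableSet s → s ⊆ A n → ∀ φ : StrongDual ℂ D,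
      φ (∫ x in s, k x ∂μ) = ∫ x in s, φ (k x) ∂μ := fun s n hs hsn φ =>
    (φ.integral_comp_comm ((hint n).mono_set hsn)).symm
  have hintφ : ∀ s n, s ⊆ A n → ∀ φ : StrongDual ℂ D,
      IntegrableOn (fun x => φ (k x)) s μ := fun s n hsn φ =>
    φ.integrable_comp ((hint n).mono_set hsn)
  have pos : ∀ s n, MeasurableSet s → s ⊆ A n → 0 ≤ ∫ x in s, k x ∂μ := fun s n hs hsn =>
    nonneg_of_weak_integral (bochner s n hs hsn) (hintφ s n hsn) hk0
  have dom : ∀ s n (hs : MeasurableSet s), s ⊆ A n → ∫ x in s, k x ∂μ ≤ ν s hs := by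
    intro s n hs hsn
    rw [← sub_nonneg]
    refine nonneg_of_weak_integral (μ := μ) (k := fun x => l x - k x) (s := s) (fun φ => ?_)
      (fun φ => ?_) (fun x => sub_nonneg.mpr (hkl x))
    · simp only [map_sub]
      rw [hν, bochner s n hs hsn, integral_sub (hl.integrable φ).integrableOn (hintφ s n hsn φ)]
    · simp only [map_sub]
      exact (hl.integrable φ).integrableOn.sub (hintφ s n hsn φ)
  have normbd : ∀ s n (hs : MeasurableSet s), s ⊆ A n → ‖∫ x in s, k x ∂μ‖ ≤ ‖ν s hs‖ :=
    fun s n hs hsn => CStarAlgebra.norm_le_norm_of_nonneg_of_le (pos s n hs hsn) (dom s n hs hsn)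
  have νmono : ∀ s (hs : MeasurableSet s), ‖ν s hs‖ ≤ ‖ν Set.univ MeasurableSet.univ‖ := by
    intro s hs
    refine CStarAlgebra.norm_le_norm_of_nonneg_of_le (nonneg_of_weak_integral (hν s hs)
      (fun φ => (hl.integrable φ).integrableOn) hl0) ?_
    rw [← sub_nonneg]
    refine nonneg_of_weak_integral (μ := μ) (k := l) (s := Set.univ \ s) (fun φ => ?_)
      (fun φ => (hl.integrable φ).integrableOn) hl0
    rw [map_sub, hν, hν, setIntegral_sdiff hs (hl.integrable φ).integrableOn (Set.subset_univ s)]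
  set M := ‖ν Set.univ MeasurableSet.univ‖ with hM
  have hcover : AECover μ Filter.atTop A :=
    { ae_eventually_mem := Filter.Eventually.of_forall fun x => by
        obtain ⟨n, hn⟩ := exists_nat_ge ‖k x‖
        exact Filter.eventually_atTop.mpr ⟨n, fun m hm => hAmono hm hn⟩
      measurableSet := hA }
  -- integrability of the real-valued functions `c (φ ∘ k)`, where `c` is `re` or `im`
  have hreal : ∀ ψ : D →L[ℝ] ℝ, Integrable (fun x => ψ (k x)) μ := by
    intro ψ
    have hψm : StronglyMeasurable fun x => ψ (k x) := ψ.continuous.comp_stronglyMeasurable hkm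
    refine hcover.integrable_of_integral_norm_bounded (2 * (‖ψ‖ * M))
      (fun n => ψ.integrable_comp (hint n)) (Filter.Eventually.of_forall fun n => ?_)
    have hi : IntegrableOn (fun x => ψ (k x)) (A n) μ := ψ.integrable_comp (hint n)
    let P : Set X := {x | 0 ≤ ψ (k x)}
    have hP : MeasurableSet P := measurableSet_le measurable_const hψm.measurable
    have hb : ∀ s, MeasurableSet s → s ⊆ A n → |∫ x in s, ψ (k x) ∂μ| ≤ ‖ψ‖ * M := by
      intro s hs hsn
      have : ∫ x in s, ψ (k x) ∂μ = ψ (∫ x in s, k x ∂μ) :=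
        ψ.integral_comp_comm ((hint n).mono_set hsn)
      rw [this, ← Real.norm_eq_abs]
      refine (ψ.le_opNorm _).trans ?_
      gcongr
      exact (normbd s n hs hsn).trans (νmono s hs)
    have h1 : ∫ x in A n ∩ P, ‖ψ (k x)‖ ∂μ = ∫ x in A n ∩ P, ψ (k x) ∂μ :=
      setIntegral_congr_fun ((hA n).inter hP) fun x hx => by
        simp only [Real.norm_eq_abs]; exact abs_of_nonneg hx.2
    have h2 : ∫ x in A n \ P, ‖ψ (k x)‖ ∂μ = -∫ x in A n \ P, ψ (k x) ∂μ := by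
      rw [← integral_neg]
      exact setIntegral_congr_fun ((hA n).diff hP) fun x hx => by
        simp only [Real.norm_eq_abs]
        exact abs_of_nonpos (le_of_lt (not_le.mp hx.2))
    rw [← integral_inter_add_sdiff hP hi.norm, h1, h2]
    have h3 := hb _ ((hA n).inter hP) Set.inter_subset_left
    have h4 := hb _ ((hA n).diff hP) Set.sdiff_subset
    rw [abs_le] at h3 h4
    linarith [h3.2, h4.1]
  have hφint : ∀ φ : StrongDual ℂ D, Integrable (fun x => φ (k x)) μ := by
    intro φ
    have hre := hreal (Complex.reCLM ∘L φ.restrictScalars ℝ)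
    have him := hreal (Complex.imCLM ∘L φ.restrictScalars ℝ)
    refine (hre.ofReal (𝕜 := ℂ)).add ((him.ofReal (𝕜 := ℂ)).const_mul Complex.I) |>.congr ?_
    refine Filter.Eventually.of_forall fun x => ?_
    change ((φ (k x)).re : ℂ) + Complex.I * ((φ (k x)).im : ℂ) = φ (k x)
    rw [mul_comm, Complex.re_add_im]
  refine ⟨hφint, fun s hs => ?_⟩
  -- the integral over `s` is the limit of the integrals over `s ∩ A n`
  let v : ℕ → D := fun n => ∫ x in s ∩ A n, k x ∂μ
  have hv : CauchySeq v := by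
    refine Metric.cauchySeq_iff'.mpr fun ε hε => ?_
    obtain ⟨n, hn⟩ := exists_weak_integral_lt hl hl0 (A := fun n => (A n)ᶜ)
      (fun n => (hA n).compl) (fun a b hab => Set.compl_subset_compl.mpr (hAmono hab))
      (by rw [← Set.compl_iUnion, hAuniv, Set.compl_univ]) hε
    refine ⟨n, fun m hm => ?_⟩
    have hs' : MeasurableSet ((s ∩ A m) \ (s ∩ A n)) := (hs.inter (hA m)).diff (hs.inter (hA n))
    have hsub : (s ∩ A m) \ (s ∩ A n) ⊆ A m := fun x hx => hx.1.2
    have hsub' : (s ∩ A m) \ (s ∩ A n) ⊆ (A n)ᶜ := fun x hx hxn => hx.2 ⟨hx.1.1, hxn⟩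
    have : v m - v n = ∫ x in (s ∩ A m) \ (s ∩ A n), k x ∂μ :=
      (setIntegral_sdiff (hs.inter (hA n)) ((hint m).mono_set Set.inter_subset_right)
        (Set.inter_subset_inter_right s (hAmono hm))).symm
    rw [dist_eq_norm, this]
    exact (normbd _ m hs' hsub).trans_lt (hn _ hs' hsub' _ (hν _ hs'))
  obtain ⟨w, hw⟩ := cauchySeq_tendsto_of_complete hv
  refine ⟨w, fun φ => ?_⟩
  refine tendsto_nhds_unique ((φ.continuous.tendsto w).comp hw) ?_
  have h1 := tendsto_setIntegral_of_monotone (μ := μ) (f := fun x => φ (k x))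
    (s := fun n => s ∩ A n) (fun n => hs.inter (hA n))
    (fun a b hab => Set.inter_subset_inter_right s (hAmono hab)) (hφint φ).integrableOn
  rw [← Set.inter_iUnion, hAuniv, Set.inter_univ] at h1
  refine h1.congr fun n => ?_
  exact (bochner _ n (hs.inter (hA n)) Set.inter_subset_right φ).symm

end order

/-! #### Square integrable functions -/

/-- The square integrable maps `X → D` modulo equality almost everywhere: the strongly measurable
maps `h` such that `x ↦ h(x)⋆ h(x)` is Pettis integrable. -/
def SqIntegrable (μ : Measure X) (h : X →ₘ[μ] D) : Prop :=
  PettisIntegrable μ fun x => star (h x) * h x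

theorem SqIntegrable.add [IsFiniteMeasure μ] {h h' : X →ₘ[μ] D} (hh : SqIntegrable μ h)
    (hh' : SqIntegrable μ h') : SqIntegrable μ (h + h') := by
  let _ := CStarAlgebra.spectralOrder D
  let _ := CStarAlgebra.spectralOrderedRing D
  have h1 : PettisIntegrable μ fun x =>
      (2 : ℂ) • (star (h x) * h x + star (h' x) * h' x) :=
    (PettisIntegrable.add hh hh').clm ((2 : ℂ) • ContinuousLinearMap.id ℂ D)
  have h2 : PettisIntegrable μ fun x => star (h x + h' x) * (h x + h' x) := by
    refine h1.of_le ?_ (fun x => star_mul_self_nonneg _) fun x => ?_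
    · have := h.stronglyMeasurable.add h'.stronglyMeasurable
      exact (continuous_star.comp_stronglyMeasurable this).mul this
    · rw [← sub_nonneg]
      have h3 : (2 : ℂ) • (star (h x) * h x + star (h' x) * h' x) -
          star (h x + h' x) * (h x + h' x) = star (h x - h' x) * (h x - h' x) := by
        rw [two_smul, star_add, star_sub]
        noncomm_ring
      rw [h3]
      exact star_mul_self_nonneg _
  refine h2.congr ?_
  filter_upwards [AEEqFun.coeFn_add h h'] with x hx
  rw [hx]; rfl

theorem SqIntegrable.smul {h : X →ₘ[μ] D} (hh : SqIntegrable μ h) (c : ℂ) :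
    SqIntegrable μ (c • h) := by
  have h1 : PettisIntegrable μ fun x => (star c * c) • (star (h x) * h x) :=
    PettisIntegrable.clm hh ((star c * c) • ContinuousLinearMap.id ℂ D)
  refine h1.congr ?_
  filter_upwards [AEEqFun.coeFn_smul c h] with x hx
  rw [hx, Pi.smul_apply, star_smul, smul_mul_smul_comm]

theorem SqIntegrable.zero : SqIntegrable μ (0 : X →ₘ[μ] D) := by
  have h1 : PettisIntegrable μ fun _ : X => (0 : D) :=
    ⟨fun φ => by simp, fun s _ => ⟨0, fun φ => by simp⟩⟩
  refine h1.congr ?_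
  filter_upwards [AEEqFun.coeFn_zero (α := X) (β := D) (μ := μ)] with x hx
  simp [hx]

/-- `h ↦ h d`, pointwise right multiplication. -/
noncomputable def AEEqFun.mulRight (h : X →ₘ[μ] D) (d : D) : X →ₘ[μ] D :=
  AEEqFun.comp (fun x => x * d) (continuous_mul_const d) h

theorem AEEqFun.coeFn_mulRight (h : X →ₘ[μ] D) (d : D) :
    AEEqFun.mulRight h d =ᵐ[μ] fun x => h x * d :=
  AEEqFun.coeFn_comp _ _ _

theorem SqIntegrable.mulRight {h : X →ₘ[μ] D} (hh : SqIntegrable μ h) (d : D) :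
    SqIntegrable μ (AEEqFun.mulRight h d) := by
  have h1 := PettisIntegrable.clm hh
    ((ContinuousLinearMap.mul ℂ D (star d)) ∘L ((ContinuousLinearMap.mul ℂ D).flip d))
  refine h1.congr ?_
  filter_upwards [AEEqFun.coeFn_mulRight h d] with x hx
  rw [hx, star_mul]
  simp [mul_assoc]

/-- The products `h⋆ h'` of square integrable maps are Pettis integrable. -/
theorem SqIntegrable.star_mul [IsFiniteMeasure μ] {h h' : X →ₘ[μ] D} (hh : SqIntegrable μ h)
    (hh' : SqIntegrable μ h') : PettisIntegrable μ fun x => star (h x) * h' x := by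
  have hp : ∀ c : ℂ, PettisIntegrable μ fun x => star (h x + c • h' x) * (h x + c • h' x) := by
    intro c
    refine PettisIntegrable.congr (hh.add (hh'.smul c)) ?_
    filter_upwards [AEEqFun.coeFn_add h (c • h'), AEEqFun.coeFn_smul c h'] with x hx hx'
    rw [hx, Pi.add_apply, hx', Pi.smul_apply]
  have hs : ∀ (c : ℂ) {k : X → D}, PettisIntegrable μ k → PettisIntegrable μ fun x => c • k x :=
    fun c k hk => hk.clm (c • ContinuousLinearMap.id ℂ D)
  have key := (((hs (1 / 4) (hp 1)).add (hs (-1 / 4) (hp (-1)))).add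
    (hs (-Complex.I / 4) (hp Complex.I))).add (hs (Complex.I / 4) (hp (-Complex.I)))
  refine key.congr (Filter.Eventually.of_forall fun x => ?_)
  simp only [star_add, star_smul, add_mul, mul_add, smul_mul_assoc, mul_smul_comm, smul_add,
    smul_smul, Complex.star_def, map_neg, map_one, Complex.conj_I]
  match_scalars <;> ring_nf <;> simp [Complex.I_sq] <;> ring

/-- The space of square integrable maps from `X` to `D` modulo equality almost everywhere. -/
def sqSubmodule (μ : Measure X) [IsFiniteMeasure μ] (D : Type*) [CStarAlgebra D] :
    Submodule ℂ (X →ₘ[μ] D) where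
  carrier := {h | SqIntegrable μ h}
  add_mem' := SqIntegrable.add
  zero_mem' := SqIntegrable.zero
  smul_mem' := fun c _ hh => SqIntegrable.smul hh c

/-- The space of square integrable maps from `X` to `D`, modulo equality almost everywhere, as an
inner product module over `D`: `⟨h, h'⟩ = ∫ h(x)⋆ h'(x) dμ(x)` and `(h d)(x) = h(x) d`. -/
def SqInt (μ : Measure X) [IsFiniteMeasure μ] (D : Type*) [CStarAlgebra D] : Type _ :=
  sqSubmodule μ D

namespace SqInt

variable [IsFiniteMeasure μ]

noncomputable instance : AddCommGroup (SqInt μ D) := inferInstanceAs (AddCommGroup (sqSubmodule μ D))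

noncomputable instance : Module ℂ (SqInt μ D) := inferInstanceAs (Module ℂ (sqSubmodule μ D))

/-- The underlying class of functions. -/
def toAEEqFun (h : SqInt μ D) : X →ₘ[μ] D := h.1

noncomputable instance : CoeFun (SqInt μ D) fun _ => X → D := ⟨fun h => h.toAEEqFun⟩

theorem ext {h h' : SqInt μ D} (e : h =ᵐ[μ] h') : h = h' := Subtype.ext (AEEqFun.ext e)

theorem coeFn_add (h h' : SqInt μ D) : (h + h' : SqInt μ D) =ᵐ[μ] fun x => h x + h' x :=
  AEEqFun.coeFn_add h.1 h'.1

theorem coeFn_smul (c : ℂ) (h : SqInt μ D) : (c • h : SqInt μ D) =ᵐ[μ] fun x => c • h x :=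
  AEEqFun.coeFn_smul c h.1

theorem coeFn_zero : (0 : SqInt μ D) =ᵐ[μ] fun _ => 0 := AEEqFun.coeFn_zero

noncomputable instance : SMul Dᵐᵒᵖ (SqInt μ D) :=
  ⟨fun d h => ⟨AEEqFun.mulRight h.1 d.unop, SqIntegrable.mulRight h.2 d.unop⟩⟩

theorem coeFn_op_smul (d : Dᵐᵒᵖ) (h : SqInt μ D) :
    (d • h : SqInt μ D) =ᵐ[μ] fun x => h x * d.unop :=
  AEEqFun.coeFn_mulRight h.1 d.unop

noncomputable instance : Module Dᵐᵒᵖ (SqInt μ D) where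
  one_smul h := ext <| by
    filter_upwards [coeFn_op_smul 1 h] with x hx
    rw [hx]; simp
  mul_smul d d' h := ext <| by
    filter_upwards [coeFn_op_smul (d * d') h, coeFn_op_smul d (d' • h), coeFn_op_smul d' h]
      with x h1 h2 h3
    rw [h1, h2, h3, unop_mul, mul_assoc]
  smul_zero d := ext <| by
    filter_upwards [coeFn_op_smul d (0 : SqInt μ D), coeFn_zero (μ := μ) (D := D)] with x h1 h2
    rw [h1, h2, zero_mul]
  smul_add d h h' := ext <| by
    filter_upwards [coeFn_op_smul d (h + h'), coeFn_add (d • h) (d • h'), coeFn_op_smul d h,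
      coeFn_op_smul d h', coeFn_add h h'] with x h1 h2 h3 h4 h5
    rw [h1, h2, h3, h4, h5, add_mul]
  add_smul d d' h := ext <| by
    filter_upwards [coeFn_op_smul (d + d') h, coeFn_add (d • h) (d' • h), coeFn_op_smul d h,
      coeFn_op_smul d' h] with x h1 h2 h3 h4
    rw [h1, h2, h3, h4, unop_add, mul_add]
  zero_smul h := ext <| by
    filter_upwards [coeFn_op_smul 0 h, coeFn_zero (μ := μ) (D := D)] with x h1 h2
    rw [h1, h2, unop_zero, mul_zero]

theorem pettisIntegrable (h h' : SqInt μ D) : PettisIntegrable μ fun x => star (h x) * h' x :=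
  SqIntegrable.star_mul h.2 h'.2

noncomputable instance : InnerProductModule D (SqInt μ D) where
  ip h h' := pettisIntegral μ fun x => star (h x) * h' x
  ip_add_right x y z := by
    rw [← pettisIntegral_add (pettisIntegrable x y) (pettisIntegrable x z)]
    refine pettisIntegral_congr ?_
    filter_upwards [coeFn_add y z] with t ht
    rw [ht, mul_add]
  ip_smul_right c x y := by
    have := pettisIntegral_clm (pettisIntegrable x y) (c • ContinuousLinearMap.id ℂ D)
    refine (pettisIntegral_congr ?_).trans this
    filter_upwards [coeFn_smul c y] with t ht
    rw [ht]; simp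
  ip_op_smul_right b x y := by
    have := pettisIntegral_clm (pettisIntegrable x y) ((ContinuousLinearMap.mul ℂ D).flip b)
    refine (pettisIntegral_congr ?_).trans this
    filter_upwards [coeFn_op_smul (op b) y] with t ht
    rw [ht]; simp [mul_assoc]
  star_ip x y := by
    refine ((pettisIntegrable y x).integral_eq fun φ => ?_).symm
    let φ' : StrongDual ℂ D :=
      { toFun := fun d => star (φ (star d))
        map_add' := fun a b => by simp
        map_smul' := fun c a => by simp
        cont := continuous_star.comp (φ.continuous.comp continuous_star) }
    have h := (pettisIntegrable x y).apply_integral φ'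
    have h' : star (φ (star (pettisIntegral μ fun t => star (x t) * y t))) =
        star (∫ t, φ (star (y t) * x t) ∂μ) := by
      refine h.trans (Eq.trans ?_ integral_conj)
      refine integral_congr_ae (Filter.Eventually.of_forall fun t => ?_)
      change star (φ (star (star (x t) * y t))) = star (φ (star (y t) * x t))
      rw [star_mul, star_star]
    exact star_injective h'
  ip_self_nonneg x := by
    let _ := CStarAlgebra.spectralOrder D
    let _ := CStarAlgebra.spectralOrderedRing D
    refine CStarAlgebra.nonneg_iff_eq_star_mul_self.mp ?_
    refine nonneg_of_weak_integral (s := Set.univ) (fun φ => ?_)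
      (fun φ => ((pettisIntegrable x x).integrable φ).integrableOn) fun t => star_mul_self_nonneg _
    rw [setIntegral_univ]
    exact (pettisIntegrable x x).apply_integral φ
  eq_zero_of_ip_self x hx := by
    let _ := CStarAlgebra.spectralOrder D
    let _ := CStarAlgebra.spectralOrderedRing D
    have hP := pettisIntegrable x x
    choose ν hν using hP.exists_integral
    have hi : ∀ (s : Set X) (φ : StrongDual ℂ D),
        IntegrableOn (fun t => φ (star (x t) * x t)) s μ := fun s φ => (hP.integrable φ).integrableOn
    have hpos : ∀ s (hs : MeasurableSet s), 0 ≤ ν s hs := fun s hs =>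
      nonneg_of_weak_integral (hν s hs) (hi s) fun t => star_mul_self_nonneg _
    have hzero : ∀ s (hs : MeasurableSet s), ν s hs = 0 := by
      intro s hs
      refine le_antisymm ?_ (hpos s hs)
      have h1 : ν s hs + ν sᶜ hs.compl = 0 := by
        rw [← hx]
        refine eq_of_forall_dual fun φ => ?_
        rw [map_add, hν, hν, hP.apply_integral, integral_add_compl hs (hP.integrable φ)]
      rw [← h1]
      exact le_add_of_nonneg_right (hpos _ _)
    have hm : StronglyMeasurable fun t => star (x t) * x t :=
      (continuous_star.comp_stronglyMeasurable x.1.stronglyMeasurable).mul x.1.stronglyMeasurable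
    have h0 : (fun t => star (x t) * x t) =ᵐ[μ] 0 := by
      refine ae_eq_zero_of_forall_dual_of_isSeparable ℂ hm.isSeparable_range (fun φ => ?_)
        (Filter.Eventually.of_forall fun t => Set.mem_range_self t)
      refine (hP.integrable φ).ae_eq_zero_of_forall_setIntegral_eq_zero fun s hs _ => ?_
      rw [← hν s hs, hzero, map_zero]
    refine ext ?_
    filter_upwards [h0, coeFn_zero (μ := μ) (D := D)] with t ht ht'
    rw [ht']
    exact (CStarRing.star_mul_self_eq_zero_iff _).mp ht

end SqInt

end pettis

/-! ### Module valued coherent states -/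

/-- The module valued coherent state `|x, a⟩ = ∑ₖ a Fₖ(x) ⊗ φₖ` in `E ⊗ G`. -/
noncomputable def mvcs (B C : Type*) {A E G X ι : Type*} [CStarAlgebra A] [CStarAlgebra B]
    [CStarAlgebra C]
    [NormedAddCommGroup E] [NormedSpace ℂ E] [Module Bᵐᵒᵖ E] [HilbertModule B E] [Module A E]
    [NormedAddCommGroup G] [NormedSpace ℂ G] [Module Cᵐᵒᵖ G] [HilbertModule C G]
    (F : ι → X → E) (φ : ι → G) (x : X) (a : A) : ExtTensor B C E G :=
  ∑' k, ExtTensor.tmul B C (a • F k x) (φ k)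

/-- The reproducing kernel `K(x, y) = ⟨x, id_A | y, id_A⟩` with values in `B ⊗ C`. -/
noncomputable def mvcsKernel (A B C : Type*) {E G X ι : Type*} [CStarAlgebra A] [CStarAlgebra B]
    [CStarAlgebra C]
    [NormedAddCommGroup E] [NormedSpace ℂ E] [Module Bᵐᵒᵖ E] [HilbertModule B E] [Module A E]
    [NormedAddCommGroup G] [NormedSpace ℂ G] [Module Cᵐᵒᵖ G] [HilbertModule C G]
    (F : ι → X → E) (φ : ι → G) (x y : X) : MinTensor B C :=
  ip (mvcs B C F φ x (1 : A)) (mvcs B C F φ y (1 : A))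

/-! Closed submodules of a Hilbert module need not be complemented, but the range of an isometry `W`
with an adjoint always is: `W⋆W = 1`, so `WW⋆` is a self-adjoint idempotent with the range of `W`,
and `h = WW⋆h + (h - WW⋆h)` is the orthogonal decomposition. The work therefore lies in showing that
`W` is well defined and isometric, and that it has an adjoint. Write `ξ(x)` for the coherent state
`|x, id_A⟩`.

Isometry. Orthonormality of the `φₖ` gives `⟨ξ(x), e ⊗ φₖc⟩ = ⟨Fₖ(x), e⟩ ⊗ c`, and the relations for
the `Fₖ` then give `∫ ⟨f, ξ(x)⟩⟨ξ(x), f'⟩ dμ = ⟨f, f'⟩` on such vectors as a Bochner integral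
(`coherent_resolution_tmul`), hence on their linear span, which is dense
(`span_frameSet_topologicalClosure`). For general `f` the integral exists only in the Pettis sense.
If `aₙ → f` with `aₙ` in the span, then `W aₙ` is Cauchy in a space not known to be complete.
However, its values converge at almost every `x` to `⟨ξ(x), f⟩`, and a Cauchy sequence with an
almost everywhere limit does converge, by a Fatou type argument on sets of uniform boundedness
(`SqInt.exists_limit`). Polarization passes from inner squares to inner products.

Adjoint. Formally `W⋆h = ∫ ξ(x)h(x) dμ(x)`. This is a Bochner integral when `h` is cut off to a set
where `ξ` and `h` are bounded. The cut-offs tend to `h` in norm, since a positive Pettis integrable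
function has tails small in norm (`SqInt.exists_truncation`), and the vectors with a value of the
adjoint form a closed set because the domain of `W` is complete (`exists_adjoint_of_approx`).

Kernel. `(WW⋆h)(x) = ⟨ξ(x), W⋆h⟩ = ⟨Wξ(x), h⟩`, and `(Wξ(x))(y)⋆ = K(x, y)`. In a completion `M`,
the isometry `j ∘ W` has an adjoint on the dense range of `j`, hence everywhere by the same
closedness, and the same algebra applies. -/

namespace InnerProductModule

variable (B : Type*) {E : Type*} [CStarAlgebra B]

/-! ### Cauchy–Schwarz and the seminorm of an inner product module. -/

section inner
variable [AddCommGroup E] [Module ℂ E] [Module Bᵐᵒᵖ E] [InnerProductModule B E]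

theorem ip_neg_right (x y : E) : ip (B := B) x (-y) = -ip x y := by
  rw [← neg_one_smul ℂ y, ip_smul_right, neg_one_smul]

theorem ip_neg_left (x y : E) : ip (B := B) (-x) y = -ip x y := by
  rw [← star_ip, ip_neg_right, star_neg, star_ip]

theorem ip_sub_right (x y z : E) : ip (B := B) x (y - z) = ip x y - ip x z := by
  rw [sub_eq_add_neg, ip_add_right, ip_neg_right, ← sub_eq_add_neg]

theorem ip_sub_left (x y z : E) : ip (B := B) (x - y) z = ip x z - ip y z := by
  rw [← star_ip, ip_sub_right, star_sub, star_ip, star_ip]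

/-- A scalar acts in the same way as the corresponding multiple of the unit. -/
theorem op_smul_one_smul (c : ℂ) (x : E) : op (c • (1 : B)) • x = c • x := by
  refine ext_ip B fun z => ?_
  rw [ip_op_smul_right, ip_smul_right, mul_smul_comm, mul_one]

/-- The Cauchy–Schwarz inequality. -/
theorem norm_ip_sq_le (x y : E) :
    ‖(ip x y : B)‖ ^ 2 ≤ ‖(ip x x : B)‖ * ‖(ip y y : B)‖ := by
  let _ := CStarAlgebra.spectralOrder B
  let _ := CStarAlgebra.spectralOrderedRing B
  rcases eq_or_ne (ip x x : B) 0 with hx | hx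
  · rw [eq_zero_of_ip_self x hx, ip_zero_left, norm_zero, zero_pow two_ne_zero]
    positivity
  set b : B := ip x y with hb
  set t : ℝ := ‖(ip x x : B)‖ with ht
  have ht0 : 0 < t := norm_pos_iff.mpr hx
  have hyx : (ip y x : B) = star b := (star_ip x y).symm
  have h1 : star b * ip x x * b ≤ t • (star b * b) :=
    CStarAlgebra.star_left_conjugate_le_norm_smul (IsSelfAdjoint.star_eq (star_ip x x))
  -- With `b = ⟨x, y⟩` and `t = ‖⟨x, x⟩‖`, the inner square of `x b - t y` is `b⋆⟨x, x⟩b - 2t b⋆b +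
  -- t²⟨y, y⟩`. Bounding its first term by `t b⋆b` leaves `t b⋆b ≤ t²⟨y, y⟩`, and norms are monotone
  -- on positive elements.
  obtain ⟨c, hc⟩ := ip_self_nonneg (B := B) (op b • x - (t : ℂ) • y)
  have h2 : (0 : B) ≤ star c * c := star_mul_self_nonneg c
  have h3 : star c * c = star b * ip x x * b - (2 * t) • (star b * b) + t ^ 2 • (ip y y : B) := by
    rw [← hc]
    simp only [ip_sub_left, ip_sub_right, ip_op_smul_left, ip_op_smul_right, ip_smul_left,
      ip_smul_right, ← hb, hyx, Complex.star_def, Complex.conj_ofReal, smul_sub]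
    simp only [Complex.coe_smul, sub_mul, smul_mul_assoc, mul_assoc]
    module
  have h4 : t • (star b * b) ≤ t ^ 2 • (ip y y : B) := by
    have h5 := add_nonneg h2 (sub_nonneg.mpr h1)
    rw [h3] at h5
    refine sub_nonneg.mp (h5.trans_eq ?_)
    module
  have h6 := CStarAlgebra.norm_le_norm_of_nonneg_of_le
    (smul_nonneg ht0.le (star_mul_self_nonneg b)) h4
  rw [norm_smul, norm_smul, CStarRing.norm_star_mul_self, Real.norm_of_nonneg ht0.le,
    Real.norm_of_nonneg (by positivity)] at h6
  have h7 : t * (‖b‖ * ‖b‖) ≤ t * (t * ‖(ip y y : B)‖) := by linarith [h6]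
  rw [sq]
  exact le_of_mul_le_mul_left h7 ht0

/-- The polarization identity: a module map which preserves `⟨x, x⟩` preserves inner products. -/
theorem ip_eq_of_ip_self_eq {M N : Type*} [AddCommGroup M] [Module ℂ M] [Module Bᵐᵒᵖ M]
    [InnerProductModule B M] [AddCommGroup N] [Module ℂ N] [Module Bᵐᵒᵖ N]
    [InnerProductModule B N] (T : M →ₗ[Bᵐᵒᵖ] N)
    (hT : ∀ x, ip (B := B) (T x) (T x) = ip x x)
    (x y : M) : ip (B := B) (T x) (T y) = ip x y := by
  have hc : ∀ (c : ℂ) (z : M), T (c • z) = c • T z := fun c z => by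
    rw [← op_smul_one_smul B, map_smul, op_smul_one_smul]
  -- The vector `x + y` yields the sum `⟨x, y⟩ + ⟨y, x⟩`, and `x + i y` yields `i` times the
  -- difference. Half of their sum is `⟨x, y⟩`.
  have h1 := hT (x + y)
  have h2 := hT (x + Complex.I • y)
  simp only [map_add, hc, ip_add_left, ip_add_right, ip_smul_left, ip_smul_right, hT,
    Complex.star_def, Complex.conj_I] at h1 h2
  have h3 : ip (B := B) (T x) (T y) + ip (T y) (T x) = ip x y + ip y x :=
    (sub_eq_zero.mp ((by module : _ = _ - _).trans (sub_eq_zero.mpr h1)))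
  have h4 : ip (B := B) (T x) (T y) - ip (T y) (T x) = ip x y - ip y x := by
    have h5 : Complex.I • (ip (B := B) (T x) (T y) - ip (T y) (T x)) =
        Complex.I • (ip x y - ip y x) :=
      (sub_eq_zero.mp ((by module : _ = _ - _).trans (sub_eq_zero.mpr h2)))
    exact smul_right_injective _ Complex.I_ne_zero h5
  have h6 : (2 : ℂ) • ip (B := B) (T x) (T y) = (2 : ℂ) • ip x y := by
    have : (2 : ℂ) • ip (B := B) (T x) (T y) =
      (ip (B := B) (T x) (T y) + ip (T y) (T x)) + (ip (T x) (T y) - ip (T y) (T x)) := by module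
    rw [this, h3, h4]; module
  exact smul_right_injective _ two_ne_zero h6

/-- The norm `‖⟨x, x⟩‖ ^ (1/2)` of an inner product module. -/
noncomputable def nrm (x : E) : ℝ := √‖(ip x x : B)‖

theorem nrm_nonneg (x : E) : 0 ≤ nrm B x := Real.sqrt_nonneg _

theorem nrm_sq (x : E) : nrm B x ^ 2 = ‖(ip x x : B)‖ := Real.sq_sqrt (norm_nonneg _)

theorem norm_ip_le (x y : E) : ‖(ip x y : B)‖ ≤ nrm B x * nrm B y := by
  refine (sq_le_sq₀ (norm_nonneg _) (mul_nonneg (nrm_nonneg B x) (nrm_nonneg B y))).mp ?_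
  rw [mul_pow, nrm_sq, nrm_sq]
  exact norm_ip_sq_le B x y

theorem nrm_neg (x : E) : nrm B (-x) = nrm B x := by
  rw [nrm, nrm, ip_neg_left, ip_neg_right, neg_neg]

theorem nrm_add_le (x y : E) : nrm B (x + y) ≤ nrm B x + nrm B y := by
  refine (sq_le_sq₀ (nrm_nonneg B _) (add_nonneg (nrm_nonneg B x) (nrm_nonneg B y))).mp ?_
  rw [nrm_sq, ip_add_left, ip_add_right, ip_add_right]
  have h1 := norm_ip_le B x x
  have h2 := norm_ip_le B x y
  have h3 := norm_ip_le B y x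
  have h4 := norm_ip_le B y y
  have h5 := norm_add_le (ip x x + ip x y : B) (ip y x + ip y y)
  have h6 := norm_add_le (ip x x : B) (ip x y)
  have h7 := norm_add_le (ip y x : B) (ip y y)
  nlinarith

theorem nrm_sub_le (x y z : E) : nrm B (x - z) ≤ nrm B (x - y) + nrm B (y - z) := by
  simpa using nrm_add_le B (x - y) (y - z)

theorem nrm_sub_comm (x y : E) : nrm B (x - y) = nrm B (y - x) := by
  rw [← nrm_neg, neg_sub]

/-- With `d = u n - x` the difference of the inner squares is `⟨d, d⟩ + ⟨d, x⟩ + ⟨x, d⟩`, and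
Cauchy–Schwarz bounds each term. Convergence is phrased through `nrm` because the module here
carries no topology; this is the situation of `SqInt`. -/
theorem tendsto_ip_self_of_tendsto_nrm {u : ℕ → E} {x : E}
    (h : Filter.Tendsto (fun n => nrm B (u n - x)) Filter.atTop (nhds 0)) :
    Filter.Tendsto (fun n => (ip (u n) (u n) : B)) Filter.atTop (nhds (ip x x)) := by
  refine tendsto_iff_norm_sub_tendsto_zero.mpr ?_
  have hlim : Filter.Tendsto (fun n => nrm B (u n - x) * (nrm B (u n - x) + 2 * nrm B x))
      Filter.atTop (nhds 0) := by
    simpa using h.mul (h.add_const (2 * nrm B x))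
  refine squeeze_zero (fun _ => norm_nonneg _) (fun n => ?_) hlim
  have h1 : (ip (u n) (u n) : B) - ip x x =
      ip (u n - x) (u n - x) + (ip (u n - x) x + ip x (u n - x)) := by
    simp only [ip_sub_left, ip_sub_right]
    abel
  rw [h1]
  have h2 := norm_ip_le B (u n - x) (u n - x)
  have h3 := norm_ip_le B (u n - x) x
  have h4 := norm_ip_le B x (u n - x)
  have h5 := norm_add_le (ip (u n - x) (u n - x) : B) (ip (u n - x) x + ip x (u n - x))
  have h6 := norm_add_le (ip (u n - x) x : B) (ip x (u n - x))
  linarith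

end inner

/-! ### Continuity in Hilbert modules, and adjoints obtained by approximation. -/

section hilbert
variable [NormedAddCommGroup E] [NormedSpace ℂ E] [Module Bᵐᵒᵖ E] [HilbertModule B E]

theorem nrm_eq_norm (x : E) : nrm B x = ‖x‖ := by
  rw [nrm, ← HilbertModule.norm_sq_eq, Real.sqrt_sq (norm_nonneg x)]

theorem norm_ip_le_norm (x y : E) : ‖(ip x y : B)‖ ≤ ‖x‖ * ‖y‖ := by
  simpa only [nrm_eq_norm] using norm_ip_le B x y

/-- The bounded linear map `y ↦ ⟨x, y⟩`. -/
noncomputable def ipL (x : E) : E →L[ℂ] B :=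
  LinearMap.mkContinuous
    { toFun := fun y => ip x y
      map_add' := ip_add_right x
      map_smul' := fun c y => ip_smul_right c x y } ‖x‖ (norm_ip_le_norm B x)

theorem ipL_apply (x y : E) : ipL B x y = ip x y := rfl

/-- Joint continuity transfers strong measurability from vector-valued maps to their inner products.
-/
theorem continuous_ip : Continuous fun p : E × E => (ip p.1 p.2 : B) := by
  refine continuous_iff_continuousAt.mpr fun p => ?_
  refine tendsto_iff_norm_sub_tendsto_zero.mpr ?_
  have h : Filter.Tendsto (fun q : E × E => ‖q.1 - p.1‖ * ‖q.2‖ + ‖p.1‖ * ‖q.2 - p.2‖)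
      (nhds p) (nhds (‖p.1 - p.1‖ * ‖p.2‖ + ‖p.1‖ * ‖p.2 - p.2‖)) :=
    Continuous.tendsto (by fun_prop) p
  simp only [sub_self, norm_zero, zero_mul, mul_zero, add_zero] at h
  refine squeeze_zero (fun _ => norm_nonneg _) (fun q => ?_) h
  have : (ip q.1 q.2 : B) - ip p.1 p.2 = ip (q.1 - p.1) q.2 + ip p.1 (q.2 - p.2) := by
    rw [ip_sub_left, ip_sub_right]; abel
  rw [this]
  exact (norm_add_le _ _).trans (add_le_add (norm_ip_le_norm B _ _) (norm_ip_le_norm B _ _))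

theorem norm_op_smul_le (b : B) (x : E) : ‖op b • x‖ ≤ ‖x‖ * ‖b‖ := by
  refine (sq_le_sq₀ (norm_nonneg _) (by positivity)).mp ?_
  rw [HilbertModule.norm_sq_eq (B := B), ip_op_smul_left, ip_op_smul_right]
  calc ‖star b * (ip x x * b)‖ ≤ ‖star b‖ * (‖(ip x x : B)‖ * ‖b‖) :=
        (norm_mul_le _ _).trans (mul_le_mul_of_nonneg_left (norm_mul_le _ _) (norm_nonneg _))
    _ = (‖x‖ * ‖b‖) ^ 2 := by rw [norm_star, ← HilbertModule.norm_sq_eq]; ring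

theorem continuous_op_smul : Continuous fun p : B × E => op p.1 • p.2 := by
  refine continuous_iff_continuousAt.mpr fun p => ?_
  refine tendsto_iff_norm_sub_tendsto_zero.mpr ?_
  have h : Filter.Tendsto (fun q : B × E => ‖q.2‖ * ‖q.1 - p.1‖ + ‖q.2 - p.2‖ * ‖p.1‖)
      (nhds p) (nhds (‖p.2‖ * ‖p.1 - p.1‖ + ‖p.2 - p.2‖ * ‖p.1‖)) :=
    Continuous.tendsto (by fun_prop) p
  simp only [sub_self, norm_zero, zero_mul, mul_zero, add_zero] at h
  refine squeeze_zero (fun _ => norm_nonneg _) (fun q => ?_) h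
  have : op q.1 • q.2 - op p.1 • p.2 = op (q.1 - p.1) • q.2 + op p.1 • (q.2 - p.2) := by
    rw [op_sub, sub_smul, smul_sub]; abel
  rw [this]
  exact (norm_add_le _ _).trans (add_le_add (norm_op_smul_le B _ _) (norm_op_smul_le B _ _))

variable {N : Type*} [AddCommGroup N] [Module ℂ N] [Module Bᵐᵒᵖ N] [InnerProductModule B N]

/-- The vectors at which an isometry from a Hilbert module has an adjoint form a closed set. -/
theorem exists_adjoint_of_approx (T : E →ₗ[Bᵐᵒᵖ] N)
    (hT : ∀ f f', ip (B := B) (T f) (T f') = ip f f') (n : N)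
    (h : ∀ ε > 0, ∃ n' : N, nrm B (n - n') < ε ∧ ∃ g : E, ∀ f, ip (B := B) f g = ip (T f) n') :
    ∃ g : E, ∀ f, ip (B := B) f g = ip (T f) n := by
  have := HilbertModule.complete (B := B) (E := E)
  have hpos : ∀ k : ℕ, (0 : ℝ) < 1 / (k + 1) := fun k => Nat.one_div_pos_of_nat
  choose n' hn' g hg using fun k : ℕ => h (1 / (k + 1)) (hpos k)
  have hT' : ∀ f, nrm B (T f) = ‖f‖ := fun f => by rw [← nrm_eq_norm B f, nrm, nrm, hT]
  -- Where it is defined, the adjoint of an isometry is a contraction: `‖g k - g l‖²` is the norm of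
  -- `⟨T (g k - g l), n' k - n' l⟩`, to which Cauchy–Schwarz applies. So `g` is Cauchy, and its
  -- limit exists in the complete module `E`; completeness of `N` plays no role.
  have hdist : ∀ k l, ‖g k - g l‖ ≤ nrm B (n' k - n' l) := by
    intro k l
    have h1 : ‖g k - g l‖ ^ 2 ≤ ‖g k - g l‖ * nrm B (n' k - n' l) := by
      rw [HilbertModule.norm_sq_eq (B := B), ip_sub_right, hg, hg, ← ip_sub_right, ← hT' (g k - g l)]
      exact norm_ip_le B _ _
    rcases (norm_nonneg (g k - g l)).eq_or_lt with h0 | h0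
    · rw [← h0]; exact nrm_nonneg B _
    · rw [sq] at h1
      exact le_of_mul_le_mul_left h1 h0
  have hc : CauchySeq g := by
    refine Metric.cauchySeq_iff'.mpr fun ε hε => ?_
    obtain ⟨k, hk⟩ := exists_nat_one_div_lt (half_pos hε)
    refine ⟨k, fun l hl => ?_⟩
    rw [dist_eq_norm]
    have h1 := nrm_sub_le B (n' l) n (n' k)
    rw [nrm_sub_comm B (n' l) n] at h1
    have h2 : (1 : ℝ) / (l + 1) ≤ 1 / (k + 1) := Nat.one_div_le_one_div hl
    linarith [hdist l k, hn' l, hn' k]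
  obtain ⟨g₀, hg₀⟩ := cauchySeq_tendsto_of_complete hc
  refine ⟨g₀, fun f => ?_⟩
  refine tendsto_nhds_unique (((ipL B f).continuous.tendsto g₀).comp hg₀) ?_
  refine tendsto_iff_norm_sub_tendsto_zero.mpr ?_
  have hlim : Filter.Tendsto (fun k : ℕ => nrm B (T f) * (1 / ((k : ℝ) + 1))) Filter.atTop
      (nhds 0) := by
    simpa using tendsto_one_div_add_atTop_nhds_zero_nat.const_mul (nrm B (T f))
  refine squeeze_zero (fun _ => norm_nonneg _) (fun k => ?_) hlim
  rw [Function.comp_apply, ipL_apply, hg, ← ip_sub_right]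
  refine (norm_ip_le B _ _).trans ?_
  rw [nrm_sub_comm]
  exact mul_le_mul_of_nonneg_left (hn' k).le (nrm_nonneg B _)

end hilbert

/-! ### The projection onto the range of an isometry with an adjoint. -/

section projection

variable {H N : Type*} [AddCommGroup H] [Module ℂ H] [Module Bᵐᵒᵖ H] [InnerProductModule B H]
  [AddCommGroup N] [Module ℂ N] [Module Bᵐᵒᵖ N] [InnerProductModule B N]

/-- A map with an adjoint at every vector has a linear adjoint. -/
theorem exists_linear_adjoint (T : H →ₗ[Bᵐᵒᵖ] N)
    (h : ∀ n, ∃ g : H, ∀ f, ip (B := B) f g = ip (T f) n) :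
    ∃ S : N →ₗ[Bᵐᵒᵖ] H, ∀ f n, ip (B := B) f (S n) = ip (T f) n := by
  choose S hS using h
  exact ⟨{  toFun := S
            map_add' := fun x y => ext_ip B fun z => by
              rw [hS, ip_add_right, ip_add_right, hS, hS]
            map_smul' := fun d x => ext_ip B fun z => by
              rw [RingHom.id_apply, hS, ← op_unop d, ip_op_smul_right, ip_op_smul_right, hS] },
    fun f n => hS n f⟩

/-- The range of an idempotent self-adjoint map is complemented by its orthogonal complement. -/
theorem isCompl_range_orth (P : N →ₗ[Bᵐᵒᵖ] N) (hP : P ∘ₗ P = P)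
    (hsa : ∀ n n', ip (B := B) (P n) n' = ip n (P n')) :
    IsCompl (LinearMap.range P) (orth B (LinearMap.range P)) := by
  have hPP : ∀ n, P (P n) = P n := fun n => LinearMap.congr_fun hP n
  refine isCompl_iff.mpr ⟨?_, ?_⟩
  · rw [Submodule.disjoint_def]
    intro x hx hx'
    exact eq_zero_of_ip_self (B := B) x (hx' x hx)
  · rw [codisjoint_iff, eq_top_iff]
    intro x _
    refine Submodule.mem_sup.mpr ⟨P x, ⟨x, rfl⟩, x - P x, ?_, by abel⟩
    rintro _ ⟨y, rfl⟩
    rw [hsa, map_sub, hPP, sub_self, ip_zero_right]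

variable (T : H →ₗ[Bᵐᵒᵖ] N) (hT : ∀ f f', ip (B := B) (T f) (T f') = ip f f')
  (S : N →ₗ[Bᵐᵒᵖ] H) (hS : ∀ f n, ip (B := B) f (S n) = ip (T f) n)
include hS

theorem ip_adjoint_left (f : H) (n : N) : ip (B := B) (S n) f = ip n (T f) := by
  rw [← star_ip, hS, star_ip]

theorem ip_comp_adjoint_left (n n' : N) :
    ip (B := B) ((T ∘ₗ S) n) n' = ip n ((T ∘ₗ S) n') := by
  rw [LinearMap.comp_apply, LinearMap.comp_apply, ← hS, ip_adjoint_left B T S hS]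

include hT

/-- Testing against `z` gives `⟨z, S T f⟩ = ⟨T z, T f⟩ = ⟨z, f⟩`. This identity alone makes `T ∘ₗ S`
idempotent with the same range as `T`. -/
theorem adjoint_comp_isometry : S ∘ₗ T = LinearMap.id :=
  LinearMap.ext fun f => ext_ip B fun z => by
    rw [LinearMap.comp_apply, hS, hT, LinearMap.id_apply]

theorem comp_adjoint_idem : (T ∘ₗ S) ∘ₗ (T ∘ₗ S) = T ∘ₗ S := by
  exact LinearMap.ext fun n => congrArg T
    (LinearMap.congr_fun (adjoint_comp_isometry B T hT S hS) (S n))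

theorem range_comp_adjoint : LinearMap.range (T ∘ₗ S) = LinearMap.range T := by
  refine le_antisymm (LinearMap.range_comp_le_range _ _) ?_
  rintro _ ⟨f, rfl⟩
  exact ⟨T f, congrArg T (LinearMap.congr_fun (adjoint_comp_isometry B T hT S hS) f)⟩

end projection

end InnerProductModule

/-! ### Pettis integrals obtained by exhaustion, and order estimates for them. -/

section pettis

variable {X : Type*} [MeasurableSpace X] {μ : Measure X}

/-- A Bochner integrable function is Pettis integrable. -/
theorem MeasureTheory.Integrable.pettisIntegrable {V : Type*} [NormedAddCommGroup V]
    [NormedSpace ℂ V] [CompleteSpace V] {k : X → V} (hk : Integrable k μ) :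
    PettisIntegrable μ k where
  integrable φ := φ.integrable_comp hk
  exists_integral s _ := ⟨∫ x in s, k x ∂μ, fun φ => (φ.integral_comp_comm hk.integrableOn).symm⟩

theorem pettisIntegral_eq_integral {V : Type*} [NormedAddCommGroup V]
    [NormedSpace ℂ V] [CompleteSpace V] {k : X → V} (hk : Integrable k μ) :
    pettisIntegral μ k = ∫ x, k x ∂μ :=
  hk.pettisIntegrable.integral_eq fun φ => (φ.integral_comp_comm hk).symm

/-- A function which is Bochner integrable on an exhausting sequence of sets, with integrals
that are small in norm outside of these sets, is Pettis integrable. -/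
theorem pettisIntegrable_of_exhaustion {V : Type*} [NormedAddCommGroup V]
    [NormedSpace ℂ V] [CompleteSpace V] {k : X → V} {A : ℕ → Set X}
    (hA : ∀ n, MeasurableSet (A n)) (hAmono : Monotone A) (hAuniv : ⋃ n, A n = Set.univ)
    (hint : ∀ n, IntegrableOn k (A n) μ)
    (htail : ∀ ε > 0, ∃ n, ∀ m s, MeasurableSet s → s ⊆ A m → s ⊆ (A n)ᶜ →
      ‖∫ x in s, k x ∂μ‖ < ε) :
    PettisIntegrable μ k ∧
      Filter.Tendsto (fun n => ∫ x in A n, k x ∂μ) Filter.atTop (nhds (pettisIntegral μ k)) := by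
  let _ : NormedSpace ℝ V := NormedSpace.restrictScalars ℝ ℂ V
  have hcover : AECover μ Filter.atTop A :=
    { ae_eventually_mem := Filter.Eventually.of_forall fun x => by
        obtain ⟨n, hn⟩ := Set.mem_iUnion.mp (hAuniv ▸ Set.mem_univ x)
        exact Filter.eventually_atTop.mpr ⟨n, fun m hm => hAmono hm hn⟩
      measurableSet := hA }
  -- Take `n` with tails of norm less than `1`. The part of `s` in `A n` contributes at most `∫ ‖k‖`
  -- over `A n`, the rest at most `1`.
  obtain ⟨M, hM⟩ : ∃ M, ∀ m s, MeasurableSet s → s ⊆ A m → ‖∫ x in s, k x ∂μ‖ ≤ M := by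
    obtain ⟨n, hn⟩ := htail 1 one_pos
    refine ⟨(∫ x in A n, ‖k x‖ ∂μ) + 1, fun m s hs hsm => ?_⟩
    rw [← integral_inter_add_sdiff (hA n) ((hint m).mono_set hsm)]
    refine (norm_add_le _ _).trans (add_le_add ?_ ?_)
    · refine (norm_integral_le_integral_norm _).trans ?_
      exact setIntegral_mono_set (hint n).norm (Filter.Eventually.of_forall fun x => norm_nonneg _)
        Set.inter_subset_right.eventuallyLE
    · exact (hn m _ (hs.diff (hA n)) (Set.sdiff_subset.trans hsm) fun x hx => hx.2).le
  have hm : AEStronglyMeasurable k μ := by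
    have := (aestronglyMeasurable_iUnion_iff (f := k) (μ := μ) (s := A)).mpr
      fun n => (hint n).aestronglyMeasurable
    rwa [hAuniv, Measure.restrict_univ] at this
  have hreal : ∀ ψ : V →L[ℝ] ℝ, Integrable (fun x => ψ (k x)) μ := by
    intro ψ
    -- The norm of `k` need not be integrable, but `|ψ ∘ k|` is: cutting `A n` along the sign of `ψ
    -- ∘ k` turns its integral into two integrals of `± ψ ∘ k`, each `± ψ` of a vector of norm at
    -- most `M`. The sign is read off a strongly measurable representative, so that the cut is
    -- measurable.
    refine hcover.integrable_of_integral_norm_bounded (2 * (‖ψ‖ * M))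
      (fun n => ψ.integrable_comp (hint n)) (Filter.Eventually.of_forall fun n => ?_)
    have hi : IntegrableOn (fun x => ψ (k x)) (A n) μ := ψ.integrable_comp (hint n)
    obtain ⟨k', hk'm, hk'⟩ := hm
    let P : Set X := {x | 0 ≤ ψ (k' x)}
    have hP : MeasurableSet P := measurableSet_le measurable_const
      (ψ.continuous.comp_stronglyMeasurable hk'm).measurable
    have hb : ∀ s, MeasurableSet s → s ⊆ A n → |∫ x in s, ψ (k x) ∂μ| ≤ ‖ψ‖ * M := by
      intro s hs hsn
      rw [ψ.integral_comp_comm ((hint n).mono_set hsn), ← Real.norm_eq_abs]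
      exact (ψ.le_opNorm _).trans (mul_le_mul_of_nonneg_left (hM n s hs hsn) (norm_nonneg _))
    have h1 : ∫ x in A n ∩ P, ‖ψ (k x)‖ ∂μ = ∫ x in A n ∩ P, ψ (k x) ∂μ :=
      setIntegral_congr_ae ((hA n).inter hP) <| by
        filter_upwards [hk'] with x hx hxP
        rw [hx]
        exact abs_of_nonneg hxP.2
    have h2 : ∫ x in A n \ P, ‖ψ (k x)‖ ∂μ = -∫ x in A n \ P, ψ (k x) ∂μ := by
      rw [← integral_neg]
      refine setIntegral_congr_ae ((hA n).diff hP) ?_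
      filter_upwards [hk'] with x hx hxP
      rw [hx]
      exact abs_of_nonpos (le_of_lt (not_le.mp hxP.2))
    rw [← integral_inter_add_sdiff hP hi.norm, h1, h2]
    have h3 := hb _ ((hA n).inter hP) Set.inter_subset_left
    have h4 := hb _ ((hA n).diff hP) Set.sdiff_subset
    rw [abs_le] at h3 h4
    linarith [h3.2, h4.1]
  have hφint : ∀ φ : StrongDual ℂ V, Integrable (fun x => φ (k x)) μ := by
    intro φ
    have hre := hreal (Complex.reCLM ∘L φ.restrictScalars ℝ)
    have him := hreal (Complex.imCLM ∘L φ.restrictScalars ℝ)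
    refine (hre.ofReal (𝕜 := ℂ)).add ((him.ofReal (𝕜 := ℂ)).const_mul Complex.I) |>.congr ?_
    refine Filter.Eventually.of_forall fun x => ?_
    change ((φ (k x)).re : ℂ) + Complex.I * ((φ (k x)).im : ℂ) = φ (k x)
    rw [mul_comm, Complex.re_add_im]
  -- The tail estimate makes the integrals over `s ∩ A n` a Cauchy sequence. Its limit is the weak
  -- integral over `s`, since each scalar function `φ ∘ k` is now known to be integrable.
  have key : ∀ s, MeasurableSet s → ∃ w : V,
      Filter.Tendsto (fun n => ∫ x in s ∩ A n, k x ∂μ) Filter.atTop (nhds w) ∧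
      ∀ φ : StrongDual ℂ V, φ w = ∫ x in s, φ (k x) ∂μ := by
    intro s hs
    have hv : CauchySeq fun n => ∫ x in s ∩ A n, k x ∂μ := by
      refine Metric.cauchySeq_iff'.mpr fun ε hε => ?_
      obtain ⟨n, hn⟩ := htail ε hε
      refine ⟨n, fun m hm => ?_⟩
      have hs' : MeasurableSet ((s ∩ A m) \ (s ∩ A n)) := (hs.inter (hA m)).diff (hs.inter (hA n))
      rw [dist_eq_norm, ← setIntegral_sdiff (hs.inter (hA n))
        ((hint m).mono_set Set.inter_subset_right) (Set.inter_subset_inter_right s (hAmono hm))]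
      exact hn m _ hs' (fun x hx => hx.1.2) fun x hx hxn => hx.2 ⟨hx.1.1, hxn⟩
    obtain ⟨w, hw⟩ := cauchySeq_tendsto_of_complete hv
    refine ⟨w, hw, fun φ => ?_⟩
    refine tendsto_nhds_unique ((φ.continuous.tendsto w).comp hw) ?_
    have h1 := tendsto_setIntegral_of_monotone (μ := μ) (f := fun x => φ (k x))
      (s := fun n => s ∩ A n) (fun n => hs.inter (hA n))
      (fun a b hab => Set.inter_subset_inter_right s (hAmono hab)) (hφint φ).integrableOn
    rw [← Set.inter_iUnion, hAuniv, Set.inter_univ] at h1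
    refine h1.congr fun n => ?_
    exact φ.integral_comp_comm ((hint n).mono_set Set.inter_subset_right)
  have hP : PettisIntegrable μ k := ⟨hφint, fun s hs => (key s hs).imp fun w hw => hw.2⟩
  refine ⟨hP, ?_⟩
  obtain ⟨w, hw, hw'⟩ := key Set.univ MeasurableSet.univ
  rw [hP.integral_eq fun φ => by rw [hw' φ, setIntegral_univ]]
  simpa using hw

variable {D : Type*} [CStarAlgebra D]

section order
variable [PartialOrder D] [StarOrderedRing D]

/-- The full integral minus `v` is the weak integral over the complement of `s`, hence positive, and
norms are monotone on positive elements. -/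
theorem norm_weak_integral_le_of_subset {l : X → D} (hl : PettisIntegrable μ l)
    (hl0 : ∀ x, 0 ≤ l x) {s : Set X} (hs : MeasurableSet s) {v : D}
    (hv : ∀ φ : StrongDual ℂ D, φ v = ∫ x in s, φ (l x) ∂μ) :
    ‖v‖ ≤ ‖pettisIntegral μ l‖ := by
  refine CStarAlgebra.norm_le_norm_of_nonneg_of_le
    (nonneg_of_weak_integral hv (fun φ => (hl.integrable φ).integrableOn) hl0) ?_
  rw [← sub_nonneg]
  refine nonneg_of_weak_integral (μ := μ) (k := l) (s := sᶜ) (fun φ => ?_)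
    (fun φ => (hl.integrable φ).integrableOn) hl0
  rw [map_sub, hl.apply_integral, hv, ← integral_add_compl hs (hl.integrable φ),
    add_sub_cancel_left]

/-- Positivity in a C⋆-algebra can be tested by functionals, so `nonneg_of_weak_integral` applies to
the Bochner integral of `l - k`. -/
theorem setIntegral_le_setIntegral {k l : X → D} {s : Set X} (hk : IntegrableOn k s μ)
    (hl : IntegrableOn l s μ) (hkl : ∀ x, k x ≤ l x) :
    ∫ x in s, k x ∂μ ≤ ∫ x in s, l x ∂μ := by
  rw [← sub_nonneg, ← integral_sub hl hk]
  refine nonneg_of_weak_integral (μ := μ) (k := fun x => l x - k x) (s := s)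
    (fun φ => (φ.integral_comp_comm (hl.sub hk)).symm) (fun φ => φ.integrable_comp (hl.sub hk))
    fun x => sub_nonneg.mpr (hkl x)

theorem setIntegral_nonneg_of_nonneg {k : X → D} {s : Set X} (hk : IntegrableOn k s μ)
    (hk0 : ∀ x, 0 ≤ k x) : 0 ≤ ∫ x in s, k x ∂μ := by
  simpa using setIntegral_le_setIntegral (k := fun _ => 0) (by simp) hk hk0

end order

theorem integrableOn_star_mul [IsFiniteMeasure μ] {u v : X → D} {s : Set X} {c : ℝ}
    (hs : MeasurableSet s)
    (hu : AEStronglyMeasurable u μ) (hv : AEStronglyMeasurable v μ) (hus : ∀ x ∈ s, ‖u x‖ ≤ c)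
    (hvs : ∀ x ∈ s, ‖v x‖ ≤ c) : IntegrableOn (fun x => star (u x) * v x) s μ := by
  refine Measure.integrableOn_of_bounded (M := c * c) (measure_ne_top _ _)
    ((continuous_star.comp_aestronglyMeasurable hu).mul hv) ?_
  refine (ae_restrict_iff' hs).mpr (Filter.Eventually.of_forall fun x hx => ?_)
  refine (norm_mul_le _ _).trans ?_
  rw [norm_star]
  exact mul_le_mul (hus x hx) (hvs x hx) (norm_nonneg _) ((norm_nonneg _).trans (hus x hx))

/-! ### Limits and truncations of square integrable maps. -/

namespace SqInt

variable [IsFiniteMeasure μ]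

theorem ip_def (h h' : SqInt μ D) : (ip h h' : D) = pettisIntegral μ fun x => star (h x) * h' x :=
  rfl

theorem coeFn_sub (h h' : SqInt μ D) : (h - h' : SqInt μ D) =ᵐ[μ] fun x => h x - h' x :=
  AEEqFun.coeFn_sub h.1 h'.1

theorem stronglyMeasurable (h : SqInt μ D) : StronglyMeasurable h := h.1.stronglyMeasurable

/-- A Fatou type lemma: norms of Bochner integrals of `|u|²` over sets of uniform boundedness. -/
theorem norm_setIntegral_le_of_tendsto {u : X → D} {w : ℕ → SqInt μ D} {s : Set X} {c ε : ℝ}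
    (hs : MeasurableSet s) (hws : ∀ᵐ x ∂μ, x ∈ s → ∀ m, ‖w m x‖ ≤ c)
    (hlim : ∀ᵐ x ∂μ, Filter.Tendsto (fun m => w m x) Filter.atTop (nhds (u x)))
    (hε : ∀ᶠ m in Filter.atTop, nrm D (w m) ≤ ε) :
    ‖∫ x in s, star (u x) * u x ∂μ‖ ≤ ε ^ 2 := by
  let _ := CStarAlgebra.spectralOrder D
  let _ := CStarAlgebra.spectralOrderedRing D
  have hm : ∀ m, StronglyMeasurable fun x => star (w m x) * w m x := fun m =>
    (continuous_star.comp_stronglyMeasurable (w m).stronglyMeasurable).mul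
      (w m).stronglyMeasurable
  have hb : ∀ m, ∀ᵐ x ∂(μ.restrict s), ‖star (w m x) * w m x‖ ≤ c * c := by
    intro m
    rw [ae_restrict_iff' hs]
    filter_upwards [hws] with x hx hxs
    rw [CStarRing.norm_star_mul_self]
    exact mul_self_le_mul_self (norm_nonneg _) (hx hxs m)
  -- On `s` the integrands are bounded by `c²` and the measure is finite, so dominated convergence
  -- holds in norm. Each approximating integral is at most the full inner square of `w m`, by
  -- positivity.
  have hlim' : Filter.Tendsto (fun m => ∫ x in s, star (w m x) * w m x ∂μ) Filter.atTop
      (nhds (∫ x in s, star (u x) * u x ∂μ)) := by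
    refine tendsto_integral_of_dominated_convergence (fun _ => c * c)
      (fun m => (hm m).aestronglyMeasurable) (integrable_const _) hb ?_
    refine ae_restrict_of_ae ?_
    filter_upwards [hlim] with x hx
    exact ((continuous_star.tendsto _).comp hx).mul hx
  refine le_of_tendsto hlim'.norm ?_
  filter_upwards [hε] with m hm'
  have hi : IntegrableOn (fun x => star (w m x) * w m x) s μ :=
    Measure.integrableOn_of_bounded (measure_ne_top _ _) (hm m).aestronglyMeasurable (hb m)
  have h1 := norm_weak_integral_le_of_subset (pettisIntegrable (w m) (w m))
    (fun x => star_mul_self_nonneg _) hs fun φ => (φ.integral_comp_comm hi).symm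
  rw [← ip_def, ← nrm_sq] at h1
  exact h1.trans (pow_le_pow_left₀ (nrm_nonneg D _) hm' 2)

/-- A Cauchy sequence of square integrable maps which converges almost everywhere has a square
integrable limit, and converges to it in norm. -/
theorem exists_limit {u : ℕ → SqInt μ D} {h : X →ₘ[μ] D}
    (hc : ∀ ε > 0, ∃ N, ∀ m ≥ N, ∀ n ≥ N, nrm D (u m - u n) ≤ ε)
    (hlim : ∀ᵐ x ∂μ, Filter.Tendsto (fun m => u m x) Filter.atTop (nhds (h x))) :
    ∃ h' : SqInt μ D, h'.toAEEqFun = h ∧ ∀ ε > 0, ∃ N, ∀ n ≥ N, nrm D (h' - u n) ≤ ε := by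
  let _ := CStarAlgebra.spectralOrder D
  let _ := CStarAlgebra.spectralOrderedRing D
  -- sets of uniform boundedness, together with an exceptional null set
  let A₀ : ℕ → Set X := fun n => {x | ‖h x‖ ≤ n} ∩ ⋂ m, {x | ‖u m x‖ ≤ n}
  have hA₀ : ∀ n, MeasurableSet (A₀ n) := fun n =>
    (measurableSet_le h.stronglyMeasurable.norm.measurable measurable_const).inter
      (MeasurableSet.iInter fun m =>
        measurableSet_le (u m).stronglyMeasurable.norm.measurable measurable_const)
  have hA₀mono : Monotone A₀ := fun a b hab x hx =>
    ⟨le_trans (show ‖h x‖ ≤ a from hx.1) (by exact_mod_cast hab), Set.mem_iInter.mpr fun m =>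
      le_trans (show ‖u m x‖ ≤ a from Set.mem_iInter.mp hx.2 m) (by exact_mod_cast hab)⟩
  let Z : Set X := (⋃ n, A₀ n)ᶜ
  have hZ : MeasurableSet Z := (MeasurableSet.iUnion hA₀).compl
  -- A convergent sequence is bounded, so almost every point lies in some `A₀ n`. Adjoining the null
  -- set `Z` to every `A₀ n` produces sets that exhaust all of `X`.
  have hZ0 : ∀ᵐ x ∂μ, x ∉ Z := by
    filter_upwards [hlim] with x hx hxZ
    obtain ⟨c, hc⟩ := hx.norm.bddAbove_range
    obtain ⟨n, hn⟩ := exists_nat_ge (max c ‖h x‖)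
    refine hxZ (Set.mem_iUnion.mpr ⟨n, (le_max_right _ _).trans hn, Set.mem_iInter.mpr fun m => ?_⟩)
    exact (hc (Set.mem_range_self m)).trans ((le_max_left _ _).trans hn)
  let A : ℕ → Set X := fun n => A₀ n ∪ Z
  have hA : ∀ n, MeasurableSet (A n) := fun n => (hA₀ n).union hZ
  have hAmono : Monotone A := fun a b hab => Set.union_subset_union_left _ (hA₀mono hab)
  have hAuniv : ⋃ n, A n = Set.univ := by
    rw [← Set.iUnion_union]
    exact Set.union_compl_self _
  have hAb : ∀ᵐ x ∂μ, ∀ n, x ∈ A n → ‖h x‖ ≤ n ∧ ∀ m, ‖u m x‖ ≤ n := by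
    filter_upwards [hZ0] with x hx n hxn
    have := hxn.resolve_right hx
    exact ⟨this.1, fun m => Set.mem_iInter.mp this.2 m⟩
  have hint : ∀ (v : X →ₘ[μ] D) n (c : ℝ), (∀ᵐ x ∂μ, x ∈ A n → ‖v x‖ ≤ c) →
      IntegrableOn (fun x => star (v x) * v x) (A n) μ := by
    intro v n c hv
    refine Measure.integrableOn_of_bounded (M := c * c) (measure_ne_top _ _)
      ((continuous_star.comp_stronglyMeasurable v.stronglyMeasurable).mul
        v.stronglyMeasurable).aestronglyMeasurable ?_
    rw [ae_restrict_iff' (hA n)]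
    filter_upwards [hv] with x hx hxn
    rw [CStarRing.norm_star_mul_self]
    exact mul_self_le_mul_self (norm_nonneg _) (hx hxn)
  -- the distance from `h` to `u n`, on sets of uniform boundedness
  have hdist : ∀ ε > 0, ∃ N, ∀ n ≥ N, ∀ m s, MeasurableSet s → s ⊆ A m →
      ‖∫ x in s, star (h x - u n x) * (h x - u n x) ∂μ‖ ≤ ε ^ 2 := by
    intro ε hε
    obtain ⟨N, hN⟩ := hc ε hε
    refine ⟨N, fun n hn m s hs hsm => ?_⟩
    have hsub : ∀ᵐ x ∂μ, ∀ k, (u k - u n : SqInt μ D) x = u k x - u n x :=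
      ae_all_iff.mpr fun k => coeFn_sub _ _
    refine norm_setIntegral_le_of_tendsto (w := fun k => u k - u n) (c := m + m) hs ?_ ?_ ?_
    · filter_upwards [hsub, hAb] with x hx hx' hxs k
      rw [hx]
      exact (norm_sub_le _ _).trans (add_le_add ((hx' m (hsm hxs)).2 k) ((hx' m (hsm hxs)).2 n))
    · filter_upwards [hsub, hlim] with x hx hx'
      simp only [hx]
      exact hx'.sub_const _
    · exact Filter.eventually_atTop.mpr ⟨N, fun k hk => hN k hk n hn⟩
  have hhint : ∀ n, IntegrableOn (fun x => star (h x) * h x) (A n) μ := fun n =>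
    hint h n n (by filter_upwards [hAb] with x hx hxn using (hx n hxn).1)
  have huint : ∀ k n, IntegrableOn (fun x => star (u k x) * u k x) (A n) μ := fun k n =>
    hint (u k).1 n n (by filter_upwards [hAb] with x hx hxn using (hx n hxn).2 k)
  have hdint : ∀ k n, IntegrableOn (fun x => star (h x - u k x) * (h x - u k x)) (A n) μ := by
    intro k n
    have hco := AEEqFun.coeFn_sub h (u k).1
    refine (hint (h - (u k).1) n (n + n) ?_).congr (ae_restrict_of_ae ?_)
    · filter_upwards [hAb, hco] with x hx hx' hxn
      rw [hx']
      exact (norm_sub_le _ _).trans (add_le_add (hx n hxn).1 ((hx n hxn).2 k))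
    · filter_upwards [hco] with x hx
      rw [hx]; rfl
  have hsq : SqIntegrable μ h := by
    -- The tails of `|h|²` are controlled through `|h|² ≤ 2|uₙ|² + 2|h - uₙ|²`, the difference being
    -- `|h - 2uₙ|²`. First `n` is fixed so that the last term integrates to at most `ε/4` in norm on
    -- every set of boundedness. Then the tail of the single Pettis integrable function `|uₙ|²` is
    -- made smaller than `ε/4`.
    refine (pettisIntegrable_of_exhaustion hA hAmono hAuniv hhint fun ε hε => ?_).1
    have hε' : 0 < √(ε / 4) := Real.sqrt_pos.mpr (by positivity)
    obtain ⟨n, hn⟩ := (hdist _ hε').imp fun N hN => hN N le_rfl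
    rw [Real.sq_sqrt (by positivity)] at hn
    obtain ⟨N, hN⟩ := exists_weak_integral_lt (pettisIntegrable (u n) (u n))
      (fun x => star_mul_self_nonneg _) (A := fun n => (A n)ᶜ) (fun n => (hA n).compl)
      (fun a b hab => Set.compl_subset_compl.mpr (hAmono hab))
      (by rw [← Set.compl_iUnion, hAuniv, Set.compl_univ]) (ε := ε / 4) (by positivity)
    refine ⟨N, fun m s hs hsm hsN => ?_⟩
    have hi1 := (huint n m).mono_set hsm
    have hi2 := (hdint n m).mono_set hsm
    have hi3 : IntegrableOn (fun x => (2 : ℝ) • (star (u n x) * u n x +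
        star (h x - u n x) * (h x - u n x))) s μ := (hi1.add hi2).smul (2 : ℝ)
    have hle : ∫ x in s, star (h x) * h x ∂μ ≤ (2 : ℝ) • ((∫ x in s, star (u n x) * u n x ∂μ) +
        ∫ x in s, star (h x - u n x) * (h x - u n x) ∂μ) := by
      rw [← integral_add hi1 hi2, ← integral_smul]
      refine setIntegral_le_setIntegral ((hhint m).mono_set hsm) hi3 fun x => ?_
      rw [← sub_nonneg]
      have : (2 : ℝ) • (star (u n x) * u n x + star (h x - u n x) * (h x - u n x)) -
          star (h x) * h x = star (h x - (2 : ℝ) • u n x) * (h x - (2 : ℝ) • u n x) := by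
        simp only [star_sub, star_smul, star_trivial, sub_mul, mul_sub, smul_mul_assoc,
          mul_smul_comm]
        module
      rw [this]
      exact star_mul_self_nonneg _
    have h1 := CStarAlgebra.norm_le_norm_of_nonneg_of_le
      (setIntegral_nonneg_of_nonneg ((hhint m).mono_set hsm) fun x => star_mul_self_nonneg _) hle
    rw [norm_smul, Real.norm_two] at h1
    have h2 := norm_add_le (∫ x in s, star (u n x) * u n x ∂μ)
      (∫ x in s, star (h x - u n x) * (h x - u n x) ∂μ)
    have h3 := hN s hs hsN _ fun φ => (φ.integral_comp_comm hi1).symm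
    have h4 := hn m s hs hsm
    linarith
  refine ⟨⟨h, hsq⟩, rfl, fun ε hε => ?_⟩
  obtain ⟨N, hN⟩ := hdist ε hε
  refine ⟨N, fun n hNn => ?_⟩
  have hn := hN n hNn
  have hco : (fun x => star ((⟨h, hsq⟩ - u n : SqInt μ D) x) * (⟨h, hsq⟩ - u n : SqInt μ D) x)
      =ᵐ[μ] fun x => star (h x - u n x) * (h x - u n x) := by
    filter_upwards [coeFn_sub (⟨h, hsq⟩ : SqInt μ D) (u n)] with x hx
    rw [hx]; rfl
  have hP : PettisIntegrable μ fun x => star (h x - u n x) * (h x - u n x) :=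
    (pettisIntegrable _ _).congr hco
  refine (sq_le_sq₀ (nrm_nonneg D _) hε.le).mp ?_
  rw [nrm_sq, ip_def, pettisIntegral_congr hco]
  -- The bound `ε²` on each `A m` passes to the whole space, because the integrals over the `A m`
  -- converge in norm to the Pettis integral.
  have hlim' := (pettisIntegrable_of_exhaustion hA hAmono hAuniv (hdint n) fun δ hδ => ?_).2
  · exact le_of_tendsto' hlim'.norm fun m => hn m _ (hA m) le_rfl
  · obtain ⟨N, hN⟩ := exists_weak_integral_lt hP
      (fun x => star_mul_self_nonneg _) (A := fun n => (A n)ᶜ) (fun n => (hA n).compl)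
      (fun a b hab => Set.compl_subset_compl.mpr (hAmono hab))
      (by rw [← Set.compl_iUnion, hAuniv, Set.compl_univ]) hδ
    exact ⟨N, fun m s hs hsm hsN => hN s hs hsN _ fun φ =>
      (φ.integral_comp_comm ((hdint n m).mono_set hsm)).symm⟩

/-- Square integrable maps are approximated in norm by their restrictions to the sets of an
exhausting sequence. -/
theorem exists_truncation (h : SqInt μ D) {A : ℕ → Set X} (hA : ∀ n, MeasurableSet (A n))
    (hAmono : Monotone A) (hAuniv : ⋃ n, A n = Set.univ)
    (hb : ∀ n, ∀ x ∈ A n, ‖h x‖ ≤ n) {ε : ℝ} (hε : 0 < ε) :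
    ∃ n, ∃ h' : SqInt μ D, h' =ᵐ[μ] (A n).indicator h ∧ nrm D (h - h') < ε := by
  let _ := CStarAlgebra.spectralOrder D
  let _ := CStarAlgebra.spectralOrderedRing D
  obtain ⟨n, hn⟩ := exists_weak_integral_lt (pettisIntegrable h h)
      (fun x => star_mul_self_nonneg _) (A := fun n => (A n)ᶜ) (fun n => (hA n).compl)
      (fun a b hab => Set.compl_subset_compl.mpr (hAmono hab))
      (by rw [← Set.compl_iUnion, hAuniv, Set.compl_univ]) (ε := ε ^ 2) (by positivity)
  have hm : AEStronglyMeasurable ((A n).indicator h) μ :=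
    (h.stronglyMeasurable.indicator (hA n)).aestronglyMeasurable
  have hco : AEEqFun.mk _ hm =ᵐ[μ] (A n).indicator h := AEEqFun.coeFn_mk _ hm
  have hsq : SqIntegrable μ (AEEqFun.mk _ hm) := by
    have hi : Integrable (fun x => star ((A n).indicator h x) * (A n).indicator h x) μ := by
      rw [← integrableOn_univ]
      refine integrableOn_star_mul (c := n) MeasurableSet.univ hm hm ?_ ?_ <;>
      · intro x _
        by_cases hx : x ∈ A n
        · rw [Set.indicator_of_mem hx]; exact hb n x hx
        · rw [Set.indicator_of_notMem hx, norm_zero]; positivity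
    refine hi.pettisIntegrable.congr ?_
    filter_upwards [hco] with x hx
    rw [hx]
  refine ⟨n, ⟨_, hsq⟩, hco, ?_⟩
  refine (sq_lt_sq₀ (nrm_nonneg D _) hε.le).mp ?_
  rw [nrm_sq, ip_def]
  -- The map `h - h'` is `h` off `A n` and zero on `A n`, so its inner square is the tail integral
  -- of `|h|²`, which is less than `ε²` in norm.
  refine hn _ (hA n).compl le_rfl _ fun φ => ?_
  rw [(pettisIntegrable _ _).apply_integral, ← integral_indicator (hA n).compl]
  refine integral_congr_ae ?_
  filter_upwards [hco, coeFn_sub h ⟨_, hsq⟩] with x hx hx'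
  rw [hx']
  change φ (star (h x - (AEEqFun.mk _ hm : X → D) x) * (h x - (AEEqFun.mk _ hm : X → D) x)) = _
  rw [hx]
  by_cases hxA : x ∈ A n
  · rw [Set.indicator_of_mem hxA, Set.indicator_of_notMem (Set.notMem_compl_iff.mpr hxA), sub_self,
      mul_zero, map_zero]
  · rw [Set.indicator_of_notMem hxA, Set.indicator_of_mem hxA, sub_zero]

end SqInt

end pettis

/-! ### The operators of `e` depend linearly and contractively on `e`. -/

section create

variable {B E : Type*} [CStarAlgebra B] [NormedAddCommGroup E] [NormedSpace ℂ E]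
    [Module Bᵐᵒᵖ E] [HilbertModule B E]

theorem ContinuousLinearMap.norm_completion_le {V W : Type*} [SeminormedAddCommGroup V]
    [NormedSpace ℂ V] [SeminormedAddCommGroup W] [NormedSpace ℂ W] (f : V →L[ℂ] W) :
    ‖f.completion‖ ≤ ‖f‖ := by
  refine ContinuousLinearMap.opNorm_le_bound _ (norm_nonneg f) fun x => ?_
  induction x using Completion.induction_on with
  | hp => exact isClosed_le (by fun_prop) (by fun_prop)
  | ih x =>
    rw [ContinuousLinearMap.completion_apply_coe, Completion.norm_coe, Completion.norm_coe]
    exact f.le_opNorm x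

theorem norm_create_le (e : E) : ‖create (B := B) e‖ ≤ ‖e‖ :=
  (ContinuousLinearMap.norm_completion_le (preCreate (B := B) e)).trans
    (LinearMap.mkContinuous_norm_le _ (norm_nonneg e) _)

theorem Univ.mk_add (x y : PreUniv B E) : Univ.mk (x + y) = Univ.mk x + Univ.mk y :=
  Completion.coe_add x y

theorem Univ.mk_smul (c : ℂ) (x : PreUniv B E) : Univ.mk (c • x) = c • Univ.mk x :=
  Completion.coe_smul c x

/-- Compatibility of the two actions is not an axiom of inner product modules; it is forced because
inner products separate vectors. -/
theorem op_smul_smul_comm (c : ℂ) (b : B) (e : E) : op b • c • e = c • op b • e :=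
  ext_ip B fun z => by
    rw [ip_op_smul_right, ip_smul_right, ip_smul_right, ip_op_smul_right, smul_mul_assoc]

theorem preCreate_add (e e' : E) (v : PreUniv B B) :
    preCreate (e + e') v = preCreate e v + preCreate e' v :=
  Finsupp.ext fun f => smul_add (op (v.fam f)) e e'

theorem preCreate_smul (c : ℂ) (e : E) (v : PreUniv B B) :
    preCreate (c • e) v = c • preCreate e v :=
  Finsupp.ext fun f => op_smul_smul_comm c (v.fam f) e

theorem create_add (e e' : E) : create (B := B) (e + e') = create e + create e' := by
  refine ContinuousLinearMap.ext fun v => ?_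
  induction v using Univ.denseRange_mk.induction_on with
  | hp => apply isClosed_eq <;> fun_prop
  | ih v =>
    rw [add_apply, create_mk, create_mk, create_mk, preCreate_add, Univ.mk_add]

theorem create_smul (c : ℂ) (e : E) : create (B := B) (c • e) = c • create e := by
  refine ContinuousLinearMap.ext fun v => ?_
  induction v using Univ.denseRange_mk.induction_on with
  | hp => exact isClosed_eq (ContinuousLinearMap.continuous _) (ContinuousLinearMap.continuous _)
  | ih v => rw [smul_apply, create_mk, create_mk, preCreate_smul, Univ.mk_smul]

end create

/-! ### Elementary tensors as bounded bilinear expressions, and their density. -/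

section tensor

variable {B C E G : Type*} [CStarAlgebra B] [CStarAlgebra C]
  [NormedAddCommGroup E] [NormedSpace ℂ E] [Module Bᵐᵒᵖ E] [HilbertModule B E]
  [NormedAddCommGroup G] [NormedSpace ℂ G] [Module Cᵐᵒᵖ G] [HilbertModule C G]

/-- This makes `e ⊗ g` continuous in each variable, so that it can be carried through series and
integrals. -/
theorem norm_createTensor_le (e : E) (g : G) :
    ‖createTensor (B := B) (C := C) e g‖ ≤ ‖e‖ * ‖g‖ := by
  refine (ContinuousLinearMap.norm_completion_le _).trans
    ((TensorProduct.norm_mapL_le _ _).trans ?_)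
  exact mul_le_mul (norm_create_le e) (norm_create_le g) (norm_nonneg _) (norm_nonneg _)

/-- Elementary tensors span a dense subspace of the Hilbert space tensor product, so bounded
operators are determined by their values there. -/
theorem createTensor_ext {T S : UnivTensor B C B C →L[ℂ] UnivTensor B C E G}
    (h : ∀ a b, T (UnivTensor.mk (a ⊗ₜ b)) = S (UnivTensor.mk (a ⊗ₜ b))) : T = S := by
  have hadd : ∀ x y : Univ B B ⊗[ℂ] Univ C C,
      UnivTensor.mk (x + y) = UnivTensor.mk x + UnivTensor.mk y := fun x y =>
    Completion.coe_add x y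
  refine ContinuousLinearMap.ext fun v => ?_
  induction v using UnivTensor.denseRange_mk.induction_on with
  | hp => apply isClosed_eq <;> fun_prop
  | ih v =>
    induction v with
    | zero =>
      have h0 : (UnivTensor.mk (0 : Univ B B ⊗[ℂ] Univ C C) : UnivTensor B C B C) = 0 :=
        Completion.coe_zero
      rw [h0, map_zero, map_zero]
    | add x y hx hy => rw [hadd, map_add, map_add, hx, hy]
    | tmul a b => exact h a b

theorem createTensor_mk_tmul (e : E) (g : G) (a : Univ B B) (b : Univ C C) :
    createTensor e g (UnivTensor.mk (a ⊗ₜ b)) = UnivTensor.mk (create e a ⊗ₜ create g b) := by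
  rw [createTensor_mk, TensorProduct.mapL_tmul]

theorem createTensor_add_left (e e' : E) (g : G) :
    createTensor (B := B) (C := C) (e + e') g = createTensor e g + createTensor e' g := by
  refine createTensor_ext fun a b => ?_
  rw [add_apply]
  simp only [createTensor_mk_tmul, create_add, add_apply,
    TensorProduct.add_tmul]
  exact Completion.coe_add _ _

theorem createTensor_add_right (e : E) (g g' : G) :
    createTensor (B := B) (C := C) e (g + g') = createTensor e g + createTensor e g' := by
  refine createTensor_ext fun a b => ?_
  rw [add_apply]
  simp only [createTensor_mk_tmul, create_add, add_apply,
    TensorProduct.tmul_add]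
  exact Completion.coe_add _ _

theorem createTensor_smul_left (c : ℂ) (e : E) (g : G) :
    createTensor (B := B) (C := C) (c • e) g = c • createTensor e g := by
  refine createTensor_ext fun a b => ?_
  rw [smul_apply]
  simp only [createTensor_mk_tmul, create_smul, smul_apply,
    ← TensorProduct.smul_tmul']
  exact Completion.coe_smul _ _

theorem createTensor_smul_right (c : ℂ) (e : E) (g : G) :
    createTensor (B := B) (C := C) e (c • g) = c • createTensor e g := by
  refine createTensor_ext fun a b => ?_
  rw [smul_apply]
  simp only [createTensor_mk_tmul, create_smul, smul_apply,
    TensorProduct.tmul_smul]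
  exact Completion.coe_smul _ _

variable (B C) in
/-- The bounded linear map `e ↦ e ⊗ g`. -/
noncomputable def ExtTensor.tmulLeft (g : G) : E →L[ℂ] ExtTensor B C E G :=
  LinearMap.mkContinuous
    { toFun := fun e => ExtTensor.tmul B C e g
      map_add' := fun e e' => Subtype.ext (createTensor_add_left e e' g)
      map_smul' := fun c e => Subtype.ext (createTensor_smul_left c e g) } ‖g‖
    fun e => (norm_createTensor_le e g).trans_eq (mul_comm _ _)

variable (B C) in
/-- The bounded linear map `g ↦ e ⊗ g`. -/
noncomputable def ExtTensor.tmulRight (e : E) : G →L[ℂ] ExtTensor B C E G :=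
  LinearMap.mkContinuous
    { toFun := fun g => ExtTensor.tmul B C e g
      map_add' := fun g g' => Subtype.ext (createTensor_add_right e g g')
      map_smul' := fun c g => Subtype.ext (createTensor_smul_right c e g) } ‖e‖
    fun g => norm_createTensor_le e g

/-- The bounded linear map `b ↦ b ⊗ c`. -/
noncomputable def MinTensor.tmulLeft (c : C) : B →L[ℂ] MinTensor B C :=
  LinearMap.mkContinuous
    { toFun := fun b => MinTensor.tmul b c
      map_add' := fun b b' => Subtype.ext (createTensor_add_left b b' c)
      map_smul' := fun z b => Subtype.ext (createTensor_smul_left z b c) } ‖c‖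
    fun b => (norm_createTensor_le b c).trans_eq (mul_comm _ _)

theorem MinTensor.tmul_zero (b : B) : tmul b (0 : C) = 0 := by
  refine Subtype.ext ?_
  have := createTensor_smul_right (B := B) (C := C) 0 b (0 : C)
  rwa [zero_smul, zero_smul] at this

theorem MinTensor.tmul_mul (b b' : B) (c c' : C) :
    tmul b c * tmul b' c' = tmul (b * b') (c * c') :=
  Subtype.ext (createTensor_comp b c b' c')

theorem MinTensor.star_tmul (b : B) (c : C) : star (tmul b c) = tmul (star b) (star c) :=
  Subtype.ext (adjoint_createTensor b c)

/-- The elementary tensors span a dense subspace of the exterior tensor product. -/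
theorem ExtTensor.eq_top_of_tmul_mem (S : Submodule ℂ (ExtTensor B C E G))
    (hS : IsClosed (S : Set (ExtTensor B C E G))) (h : ∀ e g, ExtTensor.tmul B C e g ∈ S) :
    S = ⊤ := by
  let ι : ExtTensor B C E G →ₗ[ℂ] (UnivTensor B C B C →L[ℂ] UnivTensor B C E G) :=
    (extTensorSub B C E G).subtype
  have hle : extTensorSub B C E G ≤ S.map ι := by
    refine Submodule.topologicalClosure_minimal _ (Submodule.span_le.mpr ?_) ?_
    · rintro _ ⟨p, rfl⟩
      exact ⟨_, h p.1 p.2, rfl⟩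
    -- The exterior tensor product is closed among all operators, so a subspace closed in it stays
    -- closed there and contains the closure of the span.
    · exact (isClosed_extTensorSub (B := B) (C := C) (E := E)
        (G := G)).isClosedEmbedding_subtypeVal.isClosedMap _ hS
  refine eq_top_iff.mpr fun x _ => ?_
  obtain ⟨y, hy, hyx⟩ := hle x.2
  have : y = x := Subtype.ext hyx
  exact this ▸ hy

end tensor

/-! ### From a weak resolution of the identity to an isometry with an adjoint. -/

section resolution

variable {D H X : Type*} [CStarAlgebra D] [NormedAddCommGroup H] [NormedSpace ℂ H]
  [Module Dᵐᵒᵖ H] [HilbertModule D H] [MeasurableSpace X] {μ : Measure X} {ξ : X → H}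

/-- If `∫ |ξ(x)⟩⟨ξ(x)| = I` holds weakly on a set of vectors, then it holds on their span. -/
theorem resolution_span {S : Set H}
    (hS : ∀ a ∈ S, ∀ b ∈ S, Integrable (fun x => star (ip (ξ x) a : D) * ip (ξ x) b) μ ∧
      ∫ x, star (ip (ξ x) a : D) * ip (ξ x) b ∂μ = ip a b)
    {f f' : H} (hf : f ∈ Submodule.span ℂ S) (hf' : f' ∈ Submodule.span ℂ S) :
    Integrable (fun x => star (ip (ξ x) f : D) * ip (ξ x) f') μ ∧
      ∫ x, star (ip (ξ x) f : D) * ip (ξ x) f' ∂μ = ip f f' := by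
  induction hf, hf' using Submodule.span_induction₂ with
  | mem_mem a b ha hb => exact hS a ha b hb
  | zero_left y hy => simp [ip_zero_right, ip_zero_left]
  | zero_right x hx => simp [ip_zero_right]
  | add_left x y z hx hy hz h1 h2 =>
    simp only [ip_add_right, ip_add_left, star_add, add_mul]
    exact ⟨h1.1.add h2.1, by rw [integral_add h1.1 h2.1, h1.2, h2.2]⟩
  | add_right x y z hx hy hz h1 h2 =>
    simp only [ip_add_right, mul_add]
    exact ⟨h1.1.add h2.1, by rw [integral_add h1.1 h2.1, h1.2, h2.2]⟩
  | smul_left r x y hx hy h =>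
    simp only [ip_smul_right, ip_smul_left, star_smul, smul_mul_assoc]
    exact ⟨h.1.smul (star r), by rw [integral_smul, h.2]⟩
  | smul_right r x y hx hy h =>
    simp only [ip_smul_right, mul_smul_comm]
    exact ⟨h.1.smul r, by rw [integral_smul, h.2]⟩

variable [IsFiniteMeasure μ] (hξm : AEStronglyMeasurable ξ μ)
include hξm

section isometry

variable {S : Set H}
  (hS : ∀ a ∈ S, ∀ b ∈ S, Integrable (fun x => star (ip (ξ x) a : D) * ip (ξ x) b) μ ∧
    ∫ x, star (ip (ξ x) a : D) * ip (ξ x) b ∂μ = ip a b)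
  (hd : (Submodule.span ℂ S).topologicalClosure = ⊤)
include hS hd

/-- For every `f` the function `x ↦ ⟨ξ(x), f⟩` is square integrable, with the same inner product
square as `f`. -/
theorem exists_sqInt_of_resolution (f : H) :
    ∃ w : SqInt μ D, (w =ᵐ[μ] fun x => ip (ξ x) f) ∧
      (ip w w : D) = ip f f := by
  have hm : ∀ f, AEStronglyMeasurable (fun x => (ip (ξ x) f : D)) μ := fun f =>
    (continuous_ip D).comp_aestronglyMeasurable
      (hξm.prodMk aestronglyMeasurable_const)
  have h0 : ∀ f ∈ Submodule.span ℂ S, ∃ w : SqInt μ D, w =ᵐ[μ] fun x => ip (ξ x) f := by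
    intro f hf
    refine ⟨⟨AEEqFun.mk _ (hm f), ?_⟩, AEEqFun.coeFn_mk _ (hm f)⟩
    have := (resolution_span hS hf hf).1.pettisIntegrable
    refine PettisIntegrable.congr this ?_
    filter_upwards [AEEqFun.coeFn_mk _ (hm f)] with x hx
    rw [hx]
  have h1 : ∀ f ∈ Submodule.span ℂ S, ∀ w : SqInt μ D,
      (w =ᵐ[μ] fun x => ip (ξ x) f) → (ip w w : D) = ip f f := by
    intro f hf w hw
    have h := resolution_span hS hf hf
    rw [← h.2, ← pettisIntegral_eq_integral h.1, SqInt.ip_def]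
    refine pettisIntegral_congr ?_
    filter_upwards [hw] with x hx
    rw [hx]
  have hd : f ∈ closure (Submodule.span ℂ S : Set H) := by
    have : f ∈ (Submodule.span ℂ S).topologicalClosure := hd ▸ Submodule.mem_top
    exact this
  obtain ⟨a, ha, hlim⟩ := mem_closure_iff_seq_limit.mp hd
  choose u hu using fun n => h0 (a n) (ha n)
  -- On the span the map is already isometric, so convergence of `a` makes `u` Cauchy.
  have hnrm : ∀ m n, nrm D (u m - u n) = ‖a m - a n‖ := by
    intro m n
    rw [← nrm_eq_norm D, nrm, nrm]
    rw [h1 (a m - a n) (Submodule.sub_mem _ (ha m) (ha n)) (u m - u n)]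
    filter_upwards [hu m, hu n, SqInt.coeFn_sub (u m) (u n)] with x h2 h3 h4
    rw [h4, h2, h3, ip_sub_right]
  -- The limit is identified beforehand: `⟨ξ(x), aₙ⟩ → ⟨ξ(x), f⟩` for fixed `x`, outside the
  -- countable union of null sets where some representative `u n` differs.
  obtain ⟨w, hw, hw'⟩ := SqInt.exists_limit (u := u) (h := AEEqFun.mk _ (hm f))
    (fun ε hε => by
      obtain ⟨N, hN⟩ := Metric.cauchySeq_iff.mp hlim.cauchySeq ε hε
      refine ⟨N, fun m hm n hn => ?_⟩
      rw [hnrm, ← dist_eq_norm]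
      exact (hN m hm n hn).le) (by
      filter_upwards [AEEqFun.coeFn_mk _ (hm f), ae_all_iff.mpr hu] with x hx hx'
      simp only [hx, hx']
      exact ((ipL D (ξ x)).continuous.tendsto f).comp hlim)
  refine ⟨w, by rw [hw]; exact AEEqFun.coeFn_mk _ (hm f), ?_⟩
  have h2 : Filter.Tendsto (fun n => nrm D (u n - w)) Filter.atTop (nhds 0) := by
    refine Metric.tendsto_atTop.mpr fun ε hε => ?_
    obtain ⟨N, hN⟩ := hw' (ε / 2) (half_pos hε)
    refine ⟨N, fun n hn => ?_⟩
    rw [Real.dist_0_eq_abs, abs_of_nonneg (nrm_nonneg _ _), nrm_sub_comm]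
    linarith [hN n hn]
  refine tendsto_nhds_unique (tendsto_ip_self_of_tendsto_nrm _ h2) ?_
  have h3 : (fun n => (ip (u n) (u n) : D)) = fun n => ip (a n) (a n) :=
    funext fun n => h1 _ (ha n) _ (hu n)
  rw [h3]
  exact ((continuous_ip D).tendsto (f, f)).comp (hlim.prodMk_nhds hlim)

/-- The isometry `(W f)(x) = ⟨ξ(x), f⟩`. -/
theorem exists_isometry_of_resolution :
    ∃ W : H →ₗ[Dᵐᵒᵖ] SqInt μ D,
      (∀ f, W f =ᵐ[μ] fun x => ip (ξ x) f) ∧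
      ∀ f f', (ip (W f) (W f') : D) = ip f f' := by
  choose w hw hw' using exists_sqInt_of_resolution hξm hS hd
  let W : H →ₗ[Dᵐᵒᵖ] SqInt μ D :=
    { toFun := w
      map_add' := fun f f' => SqInt.ext <| by
        filter_upwards [hw f, hw f', hw (f + f'), SqInt.coeFn_add (w f) (w f')] with x h1 h2 h3 h4
        rw [h3, h4, h1, h2, ip_add_right]
      map_smul' := fun d f => SqInt.ext <| by
        filter_upwards [hw f, hw (d • f), SqInt.coeFn_op_smul d (w f)] with x h1 h2 h3
        rw [h2, RingHom.id_apply, h3, h1, ← ip_op_smul_right, op_unop] }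
  exact ⟨W, hw, ip_eq_of_ip_self_eq _ W hw'⟩

end isometry

/-- An isometry of the form `(W f)(x) = ⟨ξ(x), f⟩` has an adjoint. -/
theorem exists_adjoint_of_isometry (W : H →ₗ[Dᵐᵒᵖ] SqInt μ D)
    (hW : ∀ f, W f =ᵐ[μ] fun x => ip (ξ x) f)
    (hWi : ∀ f f', (ip (W f) (W f') : D) = ip f f') (h : SqInt μ D) :
    ∃ g : H, ∀ f, (ip f g : D) = ip (W f) h := by
  have := HilbertModule.complete (B := D) (E := H)
  refine exists_adjoint_of_approx _ W hWi h fun ε hε => ?_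
  -- The level sets of `‖ξ‖` need not be measurable; those of a strongly measurable representative
  -- are.
  obtain ⟨ξ', hξ'm, hξ'⟩ := hξm
  let A : ℕ → Set X := fun n => {x | ‖ξ' x‖ ≤ n} ∩ {x | ‖h x‖ ≤ n}
  have hA : ∀ n, MeasurableSet (A n) := fun n =>
    (measurableSet_le hξ'm.norm.measurable measurable_const).inter
      (measurableSet_le h.stronglyMeasurable.norm.measurable measurable_const)
  have hAmono : Monotone A := fun a b hab x hx =>
    ⟨le_trans (show ‖ξ' x‖ ≤ a from hx.1) (by exact_mod_cast hab),
      le_trans (show ‖h x‖ ≤ a from hx.2) (by exact_mod_cast hab)⟩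
  have hAuniv : ⋃ n, A n = Set.univ := Set.eq_univ_of_forall fun x => by
    obtain ⟨n, hn⟩ := exists_nat_ge (max ‖ξ' x‖ ‖h x‖)
    exact Set.mem_iUnion.mpr ⟨n, (le_max_left _ _).trans hn, (le_max_right _ _).trans hn⟩
  obtain ⟨n, h', hh', hlt⟩ := h.exists_truncation hA hAmono hAuniv (fun n x hx => hx.2) hε
  -- Formally the adjoint sends `h` to `∫ ξ(x)h(x) dμ(x)`. On `A n` the integrand is bounded by `n²`
  -- almost everywhere, so for the truncation `h'` this is a Bochner integral, and `⟨f, ·⟩` passes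
  -- under it.
  refine ⟨h', hlt, ∫ x in A n, op (h x) • ξ x ∂μ, fun f => ?_⟩
  have hi : IntegrableOn (fun x => op (h x) • ξ x) (A n) μ := by
    have hi' : IntegrableOn (fun x => op (h x) • ξ' x) (A n) μ := by
      refine Measure.integrableOn_of_bounded (M := n * n) (measure_ne_top _ _)
        ((continuous_op_smul D).comp_stronglyMeasurable
          (h.stronglyMeasurable.prodMk hξ'm)).aestronglyMeasurable ?_
      refine (ae_restrict_iff' (hA n)).mpr (Filter.Eventually.of_forall fun x hx => ?_)
      exact (norm_op_smul_le _ _ _).trans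
        (mul_le_mul hx.1 hx.2 (norm_nonneg _) (Nat.cast_nonneg n))
    refine hi'.congr (ae_restrict_of_ae ?_)
    filter_upwards [hξ'] with x hx
    rw [hx]
  have hi2 : IntegrableOn (fun x => (ip f (op (h x) • ξ x) : D)) (A n) μ :=
    (ipL D f).integrable_comp hi
  have hco : (fun x => star (W f x) * h' x) =ᵐ[μ]
      (A n).indicator fun x => (ip f (op (h x) • ξ x) : D) := by
    filter_upwards [hW f, hh'] with x h1 h2
    rw [h1, h2, star_ip]
    by_cases hx : x ∈ A n
    · rw [Set.indicator_of_mem hx, Set.indicator_of_mem hx, ip_op_smul_right]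
    · rw [Set.indicator_of_notMem hx, Set.indicator_of_notMem hx, mul_zero]
  rw [SqInt.ip_def, pettisIntegral_congr hco,
    pettisIntegral_eq_integral ((integrable_indicator_iff (hA n)).mpr hi2),
    integral_indicator (hA n)]
  exact ((ipL D f).integral_comp_comm hi).symm

end resolution

/-! ### The coherent states and their resolution of the identity. -/

section coherent

variable {B C E G X ι : Type*} [CStarAlgebra B] [CStarAlgebra C]
  [NormedAddCommGroup E] [NormedSpace ℂ E] [Module Bᵐᵒᵖ E] [HilbertModule B E]
  [NormedAddCommGroup G] [NormedSpace ℂ G] [Module Cᵐᵒᵖ G] [HilbertModule C G]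
  {F : ι → X → E} {φ : ι → G} {ξ : X → ExtTensor B C E G}

/-- Vectors whose products with `e ⊗ φₖ c` are explicit: `⟨∑ₗ Fₗ(x) ⊗ φₗ, e ⊗ φₖ c⟩`. -/
theorem ip_coherent_tmul [DecidableEq ι]
    (hφ' : ∀ k l, (ip (φ k) (φ l) : C) = if k = l then 1 else 0)
    (hξ : ∀ x, HasSum (fun k => ExtTensor.tmul B C (F k x) (φ k)) (ξ x))
    (x : X) (k : ι) (e : E) (c : C) :
    (ip (ξ x) (ExtTensor.tmul B C e (op c • φ k)) : MinTensor B C) =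
      MinTensor.tmul (ip (F k x) e) c := by
  let f := ExtTensor.tmul B C e (op c • φ k)
  -- The map `u ↦ ⟨u, f⟩` is conjugate-linear, so only its additivity and continuity are used to
  -- apply it to the series. By orthonormality just the term `l = k` survives.
  let T : ExtTensor B C E G →+ MinTensor B C :=
    { toFun := fun u => ip u f
      map_zero' := ip_zero_left _ f
      map_add' := fun u v => ip_add_left _ u v f }
  have hT : Continuous T :=
    (continuous_ip (MinTensor B C)).comp (continuous_id.prodMk continuous_const)
  have h1 := (hξ x).map T hT
  refine h1.unique ?_
  have h2 : ∀ l, T (ExtTensor.tmul B C (F l x) (φ l)) =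
      if l = k then MinTensor.tmul (ip (F l x) e) c else 0 := by
    intro l
    change (ip (ExtTensor.tmul B C (F l x) (φ l))
      (ExtTensor.tmul B C e (op c • φ k)) : MinTensor B C) = _
    rw [ExtTensor.ip_tmul, ip_op_smul_right, hφ']
    split_ifs with h
    · rw [one_mul]
    · rw [zero_mul, MinTensor.tmul_zero]
  convert hasSum_single (f := T ∘ fun l => ExtTensor.tmul B C (F l x) (φ l)) k ?_ using 1
  · rw [Function.comp_apply, h2, if_pos rfl]
  · intro l hl
    rw [Function.comp_apply, h2, if_neg hl]

/-- The set of the vectors `e ⊗ φₖ c`. -/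
noncomputable def frameSet (B C E : Type*) {G ι : Type*} [CStarAlgebra B] [CStarAlgebra C]
    [NormedAddCommGroup E] [NormedSpace ℂ E] [Module Bᵐᵒᵖ E] [HilbertModule B E]
    [NormedAddCommGroup G] [NormedSpace ℂ G] [Module Cᵐᵒᵖ G] [HilbertModule C G]
    (φ : ι → G) : Set (ExtTensor B C E G) :=
  Set.range fun p : ι × E × C => ExtTensor.tmul B C p.2.1 (op p.2.2 • φ p.1)

/-- Applying the continuous map `e ⊗ ·` to `g = ∑ₖ φₖ⟨φₖ, g⟩` puts `e ⊗ g` in the closure. The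
coefficients `⟨φₖ, g⟩` lie in `C` and not in `ℂ`, which is why the vectors `e ⊗ φₖc` with `c ∈ C`
are needed. -/
theorem span_frameSet_topologicalClosure
    (hφ : ∀ g : G, HasSum (fun k => op (ip (φ k) g : C) • φ k) g) :
    (Submodule.span ℂ (frameSet B C E φ)).topologicalClosure = ⊤ := by
  refine ExtTensor.eq_top_of_tmul_mem _ (Submodule.isClosed_topologicalClosure _) fun e g => ?_
  have h1 := (hφ g).mapL (ExtTensor.tmulRight B C e)
  refine (Submodule.isClosed_topologicalClosure
    (Submodule.span ℂ (frameSet B C E φ))).mem_of_tendsto h1 (Filter.Eventually.of_forall fun s => ?_)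
  refine sum_mem fun k _ => Submodule.le_topologicalClosure _ (Submodule.subset_span ?_)
  exact ⟨(k, e, ip (φ k) g), rfl⟩

variable [MeasurableSpace X] {μ : Measure X}

/-- Countability of `ι` makes the filter of finite subsets countably generated, so the pointwise
limit of the partial sums stays measurable. -/
theorem aestronglyMeasurable_coherent [Countable ι] (hFm : ∀ k, AEStronglyMeasurable (F k) μ)
    (hξ : ∀ x, HasSum (fun k => ExtTensor.tmul B C (F k x) (φ k)) (ξ x)) :
    AEStronglyMeasurable ξ μ := by
  refine aestronglyMeasurable_of_tendsto_ae (u := (Filter.atTop : Filter (Finset ι)))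
    (f := fun s x => ∑ k ∈ s, ExtTensor.tmul B C (F k x) (φ k)) (fun s => ?_)
    (Filter.Eventually.of_forall fun x => hξ x)
  exact Finset.aestronglyMeasurable_fun_sum s fun k _ =>
    (ExtTensor.tmulLeft B C (φ k)).continuous.comp_aestronglyMeasurable (hFm k)

/-- The norm is at most `‖e‖ ‖Fₖ(x)‖ ‖Fₗ(x)‖`, and `‖Fₖ(x)‖² = ‖⟨Fₖ(x), Fₖ(x)⟩‖` is integrable.
Integrability has to be known apart from the value of the integral, as a Bochner integral that does
not exist is `0` by convention. -/
theorem integrable_op_ip_smul (hFm : ∀ k, AEStronglyMeasurable (F k) μ)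
    (hFi : ∀ k, Integrable (fun x => (ip (F k x) (F k x) : B)) μ) (k l : ι) (e : E) :
    Integrable (fun x => op (ip (F l x) e : B) • F k x) μ := by
  have hn : ∀ k, Integrable (fun x => ‖F k x‖ ^ 2) μ := fun k =>
    (hFi k).norm.congr (Filter.Eventually.of_forall fun x => (HilbertModule.norm_sq_eq _).symm)
  have hm : AEStronglyMeasurable (fun x => op (ip (F l x) e : B) • F k x) μ :=
    (continuous_op_smul B).comp_aestronglyMeasurable
      (((continuous_ip B).comp_aestronglyMeasurable
        ((hFm l).prodMk aestronglyMeasurable_const)).prodMk (hFm k))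
  refine (((hn k).add (hn l)).const_mul ‖e‖).mono' hm (Filter.Eventually.of_forall fun x => ?_)
  refine (norm_op_smul_le B _ _).trans ?_
  calc ‖F k x‖ * ‖(ip (F l x) e : B)‖ ≤ ‖F k x‖ * (‖F l x‖ * ‖e‖) :=
        mul_le_mul_of_nonneg_left (norm_ip_le_norm B _ _) (norm_nonneg _)
    _ = ‖e‖ * (‖F k x‖ * ‖F l x‖) := by ring
    _ ≤ ‖e‖ * (‖F k x‖ ^ 2 + ‖F l x‖ ^ 2) := by
        refine mul_le_mul_of_nonneg_left ?_ (norm_nonneg _)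
        nlinarith [sq_nonneg (‖F k x‖ - ‖F l x‖), sq_nonneg (‖F k x‖), sq_nonneg (‖F l x‖)]

section frame

variable [DecidableEq ι] (hFm : ∀ k, AEStronglyMeasurable (F k) μ)
  (hFi : ∀ k, Integrable (fun x => (ip (F k x) (F k x) : B)) μ)
  (hF : ∀ k l (e : E), ∫ x, op (ip (F l x) e : B) • F k x ∂μ = if k = l then e else 0)
  (hφ' : ∀ k l, (ip (φ k) (φ l) : C) = if k = l then 1 else 0)
  (hξ : ∀ x, HasSum (fun k => ExtTensor.tmul B C (F k x) (φ k)) (ξ x))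
include hFm hFi hF hφ' hξ

/-- The resolution of the identity on the vectors `e ⊗ φₖ c`. -/
theorem coherent_resolution_tmul (k l : ι) (e e' : E) (c c' : C) :
    Integrable (fun x => star (ip (ξ x) (ExtTensor.tmul B C e (op c • φ k)) : MinTensor B C) *
        ip (ξ x) (ExtTensor.tmul B C e' (op c' • φ l))) μ ∧
      ∫ x, star (ip (ξ x) (ExtTensor.tmul B C e (op c • φ k)) : MinTensor B C) *
        ip (ξ x) (ExtTensor.tmul B C e' (op c' • φ l)) ∂μ =
      ip (ExtTensor.tmul B C e (op c • φ k)) (ExtTensor.tmul B C e' (op c' • φ l)) := by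
  have := HilbertModule.complete (B := B) (E := E)
  -- The integrand is `⟨e, Fₖ(x)⟩⟨Fₗ(x), e'⟩ ⊗ c⋆c' = T (Fₖ(x)⟨Fₗ(x), e'⟩)`, and the bounded map `T`
  -- commutes with the integral, whose value is `δₖₗ e'`.
  obtain ⟨T, hT⟩ : ∃ T : E →L[ℂ] MinTensor B C,
      ∀ v, T v = MinTensor.tmul (ip e v) (star c * c') :=
    ⟨(MinTensor.tmulLeft (star c * c')) ∘L ipL B e, fun v => rfl⟩
  have hT' : (fun x => star (ip (ξ x) (ExtTensor.tmul B C e (op c • φ k)) : MinTensor B C) *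
      ip (ξ x) (ExtTensor.tmul B C e' (op c' • φ l))) =
      fun x => T (op (ip (F l x) e' : B) • F k x) := by
    funext x
    rw [ip_coherent_tmul hφ' hξ, ip_coherent_tmul hφ' hξ, MinTensor.star_tmul, MinTensor.tmul_mul,
      star_ip, ← ip_op_smul_right, hT]
  have hi := integrable_op_ip_smul hFm hFi k l e'
  rw [hT', ExtTensor.ip_tmul, ip_op_smul_left, ip_op_smul_right, hφ']
  refine ⟨T.integrable_comp hi, (T.integral_comp_comm hi).trans ?_⟩
  rw [hF]
  split_ifs
  · rw [hT, one_mul]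
  · rw [map_zero, zero_mul, mul_zero, MinTensor.tmul_zero]

end frame

end coherent

/-! ### The main theorem. -/

theorem mainTheorem3 {A B C E G X ι : Type*} [CStarAlgebra A] [CStarAlgebra B] [CStarAlgebra C]
    -- the `A`-`B` correspondence `E` and the Hilbert `C`-module `G`
    [NormedAddCommGroup E] [NormedSpace ℂ E] [Module Bᵐᵒᵖ E] [HilbertModule B E]
    [Module A E] [IsCorrespondence A B E]
    [NormedAddCommGroup G] [NormedSpace ℂ G] [Module Cᵐᵒᵖ G] [HilbertModule C G]
    [MeasurableSpace X] (μ : Measure X) [IsFiniteMeasure μ] [Countable ι] [DecidableEq ι]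
    -- the functions `Fₖ`, with `∫ |Fₖ(x)⟩⟨Fₗ(x)| dμ(x) = δₖₗ I`
    (F : ι → X → E) (hFm : ∀ k, AEStronglyMeasurable (F k) μ)
    (hFi : ∀ k, Integrable (fun x => (ip (F k x) (F k x) : B)) μ)
    (hF : ∀ k l (e : E), ∫ x, op (ip (F l x) e : B) • F k x ∂μ = if k = l then e else 0)
    -- the elements `φₖ`, with `∑ₖ |φₖ⟩⟨φₖ| = I` and `⟨φₖ | φₗ⟩ = δₖₗ id_C`
    (φ : ι → G) (hφ : ∀ g : G, HasSum (fun k => op (ip (φ k) g : C) • φ k) g)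
    (hφ' : ∀ k l, (ip (φ k) (φ l) : C) = if k = l then 1 else 0)
    -- the series of the coherent states `|x, id_A⟩` converge
    (hsum : ∀ x, Summable fun k => ExtTensor.tmul B C ((1 : A) • F k x) (φ k)) :
    ∃ (W : ExtTensor B C E G →ₗ[(MinTensor B C)ᵐᵒᵖ] SqInt μ (MinTensor B C))
      (P : SqInt μ (MinTensor B C) →ₗ[(MinTensor B C)ᵐᵒᵖ] SqInt μ (MinTensor B C)),
      -- `(W f)(x) = ⟨x, id_A | f⟩`, and `W` is an isometry
      (∀ f, W f =ᵐ[μ] fun x => ip (mvcs B C F φ x (1 : A)) f) ∧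
      (∀ f f', (ip (W f) (W f') : MinTensor B C) = ip f f') ∧
      -- `(P h)(x) = ∫ K(x, y) h(y) dμ(y)`, and `P` is a projection with the range of `W`
      (∀ (h : SqInt μ (MinTensor B C)) (x : X),
        PettisIntegrable μ fun y => mvcsKernel A B C F φ x y * h y) ∧
      (∀ h, P h =ᵐ[μ] fun x => pettisIntegral μ fun y => mvcsKernel A B C F φ x y * h y) ∧
      P ∘ₗ P = P ∧
      (∀ h h', (ip (P h) h' : MinTensor B C) = ip h (P h')) ∧
      LinearMap.range P = LinearMap.range W ∧
      -- the range of `W` is complemented by its orthogonal complement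
      IsCompl (LinearMap.range W) (orth (MinTensor B C) (LinearMap.range W)) ∧
      -- the same holds in every completion `M` of the space of square integrable maps
      (∀ (M : Type*) [NormedAddCommGroup M] [NormedSpace ℂ M] [Module (MinTensor B C)ᵐᵒᵖ M]
        [HilbertModule (MinTensor B C) M]
        (j : SqInt μ (MinTensor B C) →ₗ[(MinTensor B C)ᵐᵒᵖ] M),
        (∀ h h', (ip (j h) (j h') : MinTensor B C) = ip h h') → DenseRange j →
        ∃ Q : M →ₗ[(MinTensor B C)ᵐᵒᵖ] M,
          Q ∘ₗ j = j ∘ₗ P ∧ Q ∘ₗ Q = Q ∧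
          (∀ m m', (ip (Q m) m' : MinTensor B C) = ip m (Q m')) ∧
          LinearMap.range Q = LinearMap.range (j ∘ₗ W) ∧
          IsCompl (LinearMap.range (j ∘ₗ W))
            (orth (MinTensor B C) (LinearMap.range (j ∘ₗ W)))) := by
  have hξ : ∀ x, HasSum (fun k => ExtTensor.tmul B C (F k x) (φ k)) (mvcs B C F φ x (1 : A)) := by
    intro x
    have := (hsum x).hasSum
    simp only [one_smul] at this
    simpa only [mvcs, one_smul] using this
  have hξm := aestronglyMeasurable_coherent hFm hξ
  have hS : ∀ a ∈ frameSet B C E φ, ∀ b ∈ frameSet B C E φ,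
      Integrable (fun x => star (ip (mvcs B C F φ x (1 : A)) a : MinTensor B C) *
        ip (mvcs B C F φ x (1 : A)) b) μ ∧
      ∫ x, star (ip (mvcs B C F φ x (1 : A)) a : MinTensor B C) *
        ip (mvcs B C F φ x (1 : A)) b ∂μ = ip a b := by
    rintro _ ⟨p, rfl⟩ _ ⟨q, rfl⟩
    exact coherent_resolution_tmul hFm hFi hF hφ' hξ p.1 q.1 p.2.1 q.2.1 p.2.2 q.2.2
  obtain ⟨W, hW, hWi⟩ := exists_isometry_of_resolution hξm hS (span_frameSet_topologicalClosure hφ)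
  obtain ⟨S, hWS⟩ := exists_linear_adjoint _ W (exists_adjoint_of_isometry hξm W hW hWi)
  have hrange := range_comp_adjoint _ W hWi S hWS
  have hidem := comp_adjoint_idem _ W hWi S hWS
  have hsa := ip_comp_adjoint_left _ W S hWS
  -- The map `y ↦ K(x, y)⋆ = ⟨ξ(y), ξ(x)⟩` represents `W ξ(x)` and is therefore square integrable.
  -- This gives Pettis integrability of `K(x, ·)h` for every `x`, not just almost every one.
  have hK : ∀ (h : SqInt μ (MinTensor B C)) (x : X),
      (fun y => star (W (mvcs B C F φ x (1 : A)) y) * h y) =ᵐ[μ]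
        fun y => mvcsKernel A B C F φ x y * h y := by
    intro h x
    filter_upwards [hW (mvcs B C F φ x (1 : A))] with y hy
    rw [hy, star_ip, mvcsKernel]
  refine ⟨W, W ∘ₗ S, hW, hWi, fun h x => (SqInt.pettisIntegrable _ h).congr (hK h x),
    fun h => ?_, hidem, hsa, hrange, ?_, ?_⟩
  -- The projection is `W ∘ₗ S` by definition; its kernel is read off from `⟨ξ(x), S h⟩ = ⟨W ξ(x),
  -- h⟩`.
  · filter_upwards [hW (S h)] with x hx
    rw [LinearMap.comp_apply, hx, hWS, SqInt.ip_def]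
    exact pettisIntegral_congr (hK h x)
  · rw [← hrange]
    exact isCompl_range_orth _ _ hidem hsa
  · intro M _ _ _ _ j hj hjd
    have hTi : ∀ f f', (ip ((j ∘ₗ W) f) ((j ∘ₗ W) f') : MinTensor B C) = ip f f' := fun f f' => by
      rw [LinearMap.comp_apply, LinearMap.comp_apply, hj, hWi]
    -- At `j h` the adjoint of `j ∘ₗ W` has the value `S h`. Every `m` is a limit of such vectors,
    -- so the adjoint exists on all of `M`.
    obtain ⟨V, hV⟩ := exists_linear_adjoint _ (j ∘ₗ W) fun m => by
      refine exists_adjoint_of_approx _ (j ∘ₗ W) hTi m fun ε hε => ?_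
      obtain ⟨h, hh⟩ := hjd.exists_dist_lt m hε
      refine ⟨j h, ?_, S h, fun f => ?_⟩
      · rwa [nrm_eq_norm, ← dist_eq_norm]
      · rw [LinearMap.comp_apply, hj, hWS]
    have hVj : ∀ h, V (j h) = S h := fun h => ext_ip (MinTensor B C) fun f => by
      rw [hV, hWS, LinearMap.comp_apply, hj]
    have hrange' := range_comp_adjoint _ (j ∘ₗ W) hTi V hV
    have hidem' := comp_adjoint_idem _ (j ∘ₗ W) hTi V hV
    have hsa' := ip_comp_adjoint_left _ (j ∘ₗ W) V hV
    refine ⟨(j ∘ₗ W) ∘ₗ V, LinearMap.ext fun h => ?_, hidem', hsa', hrange', ?_⟩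
    · exact congrArg (fun g => j (W g)) (hVj h)
    · rw [← hrange']
      exact isCompl_range_orth _ _ hidem' hsa'
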